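/- **Setting.** Alice and Bob each sell a copy of a good to one buyer with value $v\ge 0$ for one copy. The value is drawn from a probability distribution $D$ on $[0,\infty)$ with density $f$ and CDF $F$; assume that $\Gamma_D(v)=v(1-F(v))$ attains its maximum over $v\ge 0$, and let $\mathtt v$ be a maximizer. Assume that $D$ is *regular*, i.e. $\varphi_D(v)=v-\frac{1-F(v)}{f(v)}$ is non-decreasing, or has *diminishing marginal revenue* (DMR), i.e. $\varphi_D(v)f(v)=vf(v)-(1-F(v))$ is non-decreasing; both conditions are imposed on $\{v\ge 0: F(v)<1\}$, with $\varphi_D(v)=-\infty$ where $f(v)=0$. A *mechanism* is a proper pricing function $M:[0,1]\to[0,\infty]$: the buyer may receive the good with probability $x$ for an expected payment $M(x)$, where $M(0)=0$, $M$ is non-decreasing, and $M$ is continuous and convex on $[0,\bar x]$ with $\bar x=\sup\{x: M(x)<\infty\}$. The *single-lottery mechanism* with probability $z\in[0,1]$ and price $p\ge 0$ is $M(x)=px$ for $x\le z$ and $M(x)=\infty$ for $x>z$; the *fixed-price mechanism* $\mathsf{FP}_q$ is $M(x)=qx$ on $[0,1]$. Given mechanisms $(A,B)$ of Alice and Bob,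 the buyer, knowing $v$, chooses which seller to approach first and probabilities $x_A,x_B\in[0,1]$ with $A(x_A),B(x_B)<\infty$; the second seller is approached only if the first one did not allocate the good. The expected utility is $x_Av-A(x_A)+(1-x_A)(x_Bv-B(x_B))$ if Alice is first and $x_Bv-B(x_B)+(1-x_B)(x_Av-A(x_A))$ if Bob is first. The buyer maximizes expected utility, breaking ties in favor of a larger expected allocation from Bob and then of a larger expected allocation from Alice. Let $\mathsf{rev}_{\mathsf B,(A,B)}(D)$ be the resulting expected payment to Bob when $v\sim D$. **Lemma.** Let $A$ be the single-lottery mechanism with probability $z\in[0,1]$ and price $p\ge 0$. For every mechanism $B$ of Bob there is $q\ge 0$ with $$\mathsf{rev}_{\mathsf B,(A,B)}(D)\le \mathsf{rev}_{\mathsf B,(A,\mathsf{FP}_q)}(D).$$ Moreover, if $\max_{0\le\hat p\le p}\mathsf{rev}_{\mathsf B,(A,\mathsf{FP}_{\hat p})}(D)<\mathsf{rev}_{\mathsf B,(A,\mathsf{FP}_{\mathtt v})}(D)$ and under $(A,B)$ some type $v\ge p$ makes an expected payment smaller than $pz$ to Alice, then $q$ can be chosen so that the inequality is strict. -/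

import Mathlib

open MeasureTheory ProbabilityTheory Set
open scoped ENNReal

noncomputable section

namespace Duopoly

/-! ### Pricing functions -/

/-- A pricing function: `M x` is the (possibly infinite) expected payment for receiving the good
with probability `x`. Only the values on `[0, 1]` are ever used. -/
abbrev Pricing := ℝ → ℝ≥0∞

/-- The supremum of the probabilities that are offered at a finite price. -/
def maxProb (M : Pricing) : ℝ := sSup {x | x ∈ Icc (0 : ℝ) 1 ∧ M x < ∞}

/-- Proper pricing functions: zero at zero, weakly increasing on `[0, 1]`, continuous and weakly
convex on `[0, maxProb M]`. -/
structure IsProper (M : Pricing) : Prop where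
  map_zero : M 0 = 0
  monotoneOn : MonotoneOn M (Icc 0 1)
  continuousOn : ContinuousOn M (Icc 0 (maxProb M))
  convex : ∀ x ∈ Icc 0 (maxProb M), ∀ y ∈ Icc 0 (maxProb M), ∀ t ∈ Icc (0 : ℝ) 1,
    M (t * x + (1 - t) * y) ≤ ENNReal.ofReal t * M x + ENNReal.ofReal (1 - t) * M y

/-- The single-lottery mechanism with probability `z` and price `p`. -/
def singleLottery (z p : ℝ) : Pricing := fun x => if x ≤ z then ENNReal.ofReal (p * x) else ∞

/-- The fixed-price mechanism with price `q`. -/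
def fixedPrice (q : ℝ) : Pricing := fun x => ENNReal.ofReal (q * x)

/-! ### The buyer -/

inductive Seller
  | alice
  | bob

/-- A buyer strategy: the seller approached first, the probability bought from Alice and the
probability bought from Bob; the purchase from the second seller is made only if the first seller
did not allocate the good. -/
structure Strategy where
  first : Seller
  xA : ℝ
  xB : ℝ

/-- The strategy uses probabilities that are offered at a finite price. -/
def Feasible (A B : Pricing) (σ : Strategy) : Prop :=
  (σ.xA ∈ Icc (0 : ℝ) 1 ∧ A σ.xA ≠ ∞) ∧ (σ.xB ∈ Icc (0 : ℝ) 1 ∧ B σ.xB ≠ ∞)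

/-- Expected utility of a buyer with value `v` (for feasible strategies). -/
def utility (A B : Pricing) (v : ℝ) (σ : Strategy) : ℝ :=
  match σ.first with
  | .alice => (σ.xA * v - (A σ.xA).toReal) + (1 - σ.xA) * (σ.xB * v - (B σ.xB).toReal)
  | .bob => (σ.xB * v - (B σ.xB).toReal) + (1 - σ.xB) * (σ.xA * v - (A σ.xA).toReal)

/-- Expected allocation from Alice. -/
def allocA (σ : Strategy) : ℝ :=
  match σ.first with
  | .alice => σ.xA
  | .bob => (1 - σ.xB) * σ.xA

/-- Expected allocation from Bob. -/
def allocB (σ : Strategy) : ℝ :=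
  match σ.first with
  | .alice => (1 - σ.xA) * σ.xB
  | .bob => σ.xB

/-- Expected payment to Alice. -/
def payA (A : Pricing) (σ : Strategy) : ℝ≥0∞ :=
  match σ.first with
  | .alice => A σ.xA
  | .bob => ENNReal.ofReal (1 - σ.xB) * A σ.xA

/-- Expected payment to Bob. -/
def payB (B : Pricing) (σ : Strategy) : ℝ≥0∞ :=
  match σ.first with
  | .alice => ENNReal.ofReal (1 - σ.xA) * B σ.xB
  | .bob => B σ.xB

/-- The strategy `σ` is an equilibrium choice of a buyer with value `v`: it is feasible and
maximizes expected utility, ties being broken first in favor of a larger expected allocation from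
Bob and then in favor of a larger expected allocation from Alice. -/
def IsChoice (A B : Pricing) (v : ℝ) (σ : Strategy) : Prop :=
  Feasible A B σ ∧ ∀ τ, Feasible A B τ →
    utility A B v τ < utility A B v σ ∨
      (utility A B v τ = utility A B v σ ∧
        (allocB τ < allocB σ ∨ (allocB τ = allocB σ ∧ allocA τ ≤ allocA σ)))

open Classical in
/-- The strategy chosen by a buyer with value `v`. Against a single-lottery mechanism of Alice and
a proper mechanism of Bob such a choice exists, and any two choices involve the same payments. -/
def choice (A B : Pricing) (v : ℝ) : Strategy :=
  if h : ∃ σ, IsChoice A B v σ then h.choose else ⟨.bob, 0, 0⟩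

/-- Bob's expected revenue when the buyer's value has law `D`. -/
def revB (A B : Pricing) (D : Measure ℝ) : ℝ≥0∞ := ∫⁻ v, payB B (choice A B v) ∂D

/-! ### The value distribution -/

/-- `D` is a probability distribution of values `v ≥ 0` with density `f`. -/
structure IsValueDistribution (D : Measure ℝ) (f : ℝ → ℝ) : Prop where
  isProbabilityMeasure : IsProbabilityMeasure D
  measurable : Measurable f
  nonneg : ∀ v, 0 ≤ f v
  eq_withDensity : D = volume.withDensity fun v => ENNReal.ofReal (f v)
  nonneg_values : D (Iio 0) = 0

/-- The revenue curve `v (1 - F v)`. -/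
def revenueCurve (D : Measure ℝ) (v : ℝ) : ℝ := v * (1 - cdf D v)

/-- `v` is a monopolist revenue-maximizing (Myerson) price. -/
def IsMyersonPrice (D : Measure ℝ) (v : ℝ) : Prop :=
  0 ≤ v ∧ IsMaxOn (revenueCurve D) (Ici 0) v

/-- The types below the upper end of the support, where the regularity conditions are imposed. -/
def typeRange (D : Measure ℝ) : Set ℝ := {v | 0 ≤ v ∧ cdf D v < 1}

/-- The virtual value `v - (1 - F v) / f v`; it is `-∞` where `f v = 0` and `F v < 1`, because
division in `ℝ≥0∞` of a nonzero number by zero is `∞`. -/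
def virtualValue (D : Measure ℝ) (f : ℝ → ℝ) (v : ℝ) : EReal :=
  (v : EReal) - ((ENNReal.ofReal (1 - cdf D v) / ENNReal.ofReal (f v) : ℝ≥0∞) : EReal)

/-- Regularity: the virtual value is non-decreasing. -/
def IsRegular (D : Measure ℝ) (f : ℝ → ℝ) : Prop :=
  MonotoneOn (virtualValue D f) (typeRange D)

/-- Diminishing marginal revenue: virtual value times density, that is `v f(v) - (1 - F v)`, is
non-decreasing. -/
def IsDMR (D : Measure ℝ) (f : ℝ → ℝ) : Prop :=
  MonotoneOn (fun v => v * f v - (1 - cdf D v)) (typeRange D)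

end Duopoly

end

/-! Write `R t = t (1 - F t)`. If Bob is approached first, Alice's lottery is an outside option
worth `z (v - p)⁺`, so a type `v` acts like a buyer with effective value `s = v - z (v - p)⁺`. For
an offer `x` at price `b`, approaching Bob first costs `b` in these terms, and approaching Alice
first costs `z p x + (1 - z) b`, of which Bob receives only `(1 - z) b`. The first order is the
cheaper one exactly when `b ≤ p x` (for `z > 0`), so Bob faces a single-buyer problem with price
`min b (z p x + (1 - z) b)` (`IsChoice.outcome`).

Effective payments are incentive compatible, so they are integrals of a level price `β y`, the least
effective value buying at least `y` (`lintegral_levelPrice_eq`). By Fubini, Bob's revenue is at most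
an integral over levels `y` of a marginal payment times the probability that `s ≥ β y`. Let `X` be
the supremum of the quantities bought at average price at most `p`. Above `X` the marginal payment
is `β - z p`, and each level contributes at most `(1 - z) R vM`. Below `X` it is `β`, and `∫ β ≤ p
X`; a supporting line of `R` at `p` with nonnegative slope turns this into a contribution of at most
`X R p`. Regularity or DMR supplies that line when no price up to `p` is optimal for a monopolist.

Hence the revenue is at most `X R p + (1 - X) (1 - z) R vM` (`revB_le_convexCombination`), and the
prices `p` and `vM` earn at least `R p` and `(1 - z) R vM`. If some monopoly price `q ≤ p` exists,
then `q` earns the trivial upper bound `R vM`. Strictness comes from `X > 0`. -/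

namespace Duopoly

/-! ### Distribution functions and revenue curves -/

/-- An absolutely continuous function whose derivative is almost everywhere nonpositive is
weakly decreasing. -/
theorem le_of_ae_hasDerivAt_nonpos {g g' : ℝ → ℝ} {a b : ℝ} (hab : a ≤ b)
    (hg : AbsolutelyContinuousOnInterval g a b)
    (hg' : ∀ᵐ t, t ∈ Icc a b → HasDerivAt g (g' t) t) (h0 : ∀ t ∈ Icc a b, g' t ≤ 0) :
    g b ≤ g a := by
  have h1 := hg.integral_deriv_eq_sub
  have h2 : ∫ t in a..b, deriv g t ≤ ∫ _ in a..b, (0 : ℝ) := by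
    apply intervalIntegral.integral_mono_ae_restrict hab hg.intervalIntegrable_deriv (by simp)
    rw [Filter.EventuallyLE, ae_restrict_iff' measurableSet_Icc]
    filter_upwards [hg'] with t ht htab
    rw [(ht htab).deriv]
    exact h0 t htab
  simp only [intervalIntegral.integral_zero] at h2
  linarith

namespace IsValueDistribution

variable {D : Measure ℝ} {f : ℝ → ℝ}

theorem nullSingletonClass (hD : IsValueDistribution D f) : NullSingletonClass D := by
  rw [hD.eq_withDensity]; infer_instance

theorem integrable (hD : IsValueDistribution D f) : Integrable f := by
  have := hD.isProbabilityMeasure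
  refine ⟨hD.measurable.aestronglyMeasurable, ?_⟩
  rw [hasFiniteIntegral_iff_ofReal (ae_of_all _ hD.nonneg)]
  have h : D univ = ∫⁻ v, ENNReal.ofReal (f v) := by
    rw [hD.eq_withDensity, withDensity_apply _ MeasurableSet.univ, Measure.restrict_univ]
  rw [← h]
  exact measure_lt_top D univ

theorem measure_Ici (hD : IsValueDistribution D f) (t : ℝ) :
    D (Ici t) = ENNReal.ofReal (1 - cdf D t) := by
  have := hD.isProbabilityMeasure
  have := hD.nullSingletonClass
  rw [measure_congr (Ioi_ae_eq_Ici (μ := D) (a := t)).symm, ← compl_Iic,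
    prob_compl_eq_one_sub measurableSet_Iic, ENNReal.ofReal_sub _ (cdf_nonneg D t), ofReal_cdf,
    ENNReal.ofReal_one]

theorem cdf_sub_cdf (hD : IsValueDistribution D f) (a b : ℝ) :
    cdf D b - cdf D a = ∫ t in a..b, f t := by
  have := hD.isProbabilityMeasure
  have h : ∀ x, cdf D x = ∫ t in Iic x, f t := fun x => by
    rw [cdf_eq_real, integral_eq_lintegral_of_nonneg_ae (ae_of_all _ hD.nonneg)
      hD.measurable.aestronglyMeasurable, Measure.real]
    conv_lhs => rw [hD.eq_withDensity]
    rw [withDensity_apply _ measurableSet_Iic]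
  rw [h, h, intervalIntegral.integral_Iic_sub_Iic hD.integrable.integrableOn
    hD.integrable.integrableOn]

theorem cdf_eq_add_integral (hD : IsValueDistribution D f) (a : ℝ) :
    (fun t => cdf D t) = fun t => cdf D a + ∫ u in a..t, f u := by
  funext t
  rw [← hD.cdf_sub_cdf]; ring

theorem absolutelyContinuousOnInterval_cdf (hD : IsValueDistribution D f) (a b : ℝ) :
    AbsolutelyContinuousOnInterval (fun t => cdf D t) a b := by
  rw [hD.cdf_eq_add_integral a]
  have h1 : AbsolutelyContinuousOnInterval (fun _ : ℝ => cdf D a) a b :=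
    (LipschitzWith.const (cdf D a)).lipschitzOnWith.absolutelyContinuousOnInterval
  have h2 : IntervalIntegrable f volume a b := hD.integrable.intervalIntegrable
  exact h1.add (h2.absolutelyContinuousOnInterval_intervalIntegral (c := a) (by simp))

theorem ae_hasDerivAt_cdf (hD : IsValueDistribution D f) :
    ∀ᵐ t, HasDerivAt (fun t => cdf D t) (f t) t := by
  rw [hD.cdf_eq_add_integral 0]
  filter_upwards [LocallyIntegrable.ae_hasDerivAt_integral hD.integrable.locallyIntegrable] with t ht
  exact (ht 0).const_add _

/-- Virtual revenue `(t - c) (1 - F t) - l t` as an absolutely continuous function. -/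
theorem absolutelyContinuousOnInterval_shifted (hD : IsValueDistribution D f) (c l a b : ℝ) :
    AbsolutelyContinuousOnInterval (fun t => (t - c) * (1 - cdf D t) - l * t) a b := by
  have hid : ∀ k m : ℝ, AbsolutelyContinuousOnInterval (fun t : ℝ => m * t - k) a b := fun k m =>
    ContDiffOn.absolutelyContinuousOnInterval (by fun_prop)
  have h1 : AbsolutelyContinuousOnInterval (fun _ : ℝ => (1 : ℝ)) a b :=
    (LipschitzWith.const (1 : ℝ)).lipschitzOnWith.absolutelyContinuousOnInterval
  have h2 := ((hid c 1).fun_mul (h1.fun_sub (hD.absolutelyContinuousOnInterval_cdf a b))).fun_sub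
    (hid 0 l)
  simpa using h2

theorem ae_hasDerivAt_shifted (hD : IsValueDistribution D f) (c l : ℝ) :
    ∀ᵐ t, HasDerivAt (fun t => (t - c) * (1 - cdf D t) - l * t)
      ((1 - cdf D t) - (t - c) * f t - l) t := by
  filter_upwards [hD.ae_hasDerivAt_cdf] with t ht
  have := (((hasDerivAt_id t).sub_const c).mul (ht.const_sub 1)).sub ((hasDerivAt_id t).const_mul l)
  refine (this.congr_deriv ?_)
  simp; ring

/-- One function serves both distributional conditions: regularity uses `l = 0` with `c` the virtual
value at `p`, while DMR uses `c = 0` with `l` the slope of the revenue curve at `p`. -/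
theorem shifted_le_of_derivative_sign (hD : IsValueDistribution D f) {c l p t : ℝ}
    (h1 : ∀ u ∈ Icc p t, (1 - cdf D u) - (u - c) * f u - l ≤ 0)
    (h2 : ∀ u ∈ Icc t p, 0 ≤ (1 - cdf D u) - (u - c) * f u - l) :
    (t - c) * (1 - cdf D t) - l * t ≤ (p - c) * (1 - cdf D p) - l * p := by
  rcases le_total p t with h | h
  · refine le_of_ae_hasDerivAt_nonpos h (hD.absolutelyContinuousOnInterval_shifted c l p t) ?_ h1
    filter_upwards [hD.ae_hasDerivAt_shifted c l] with u hu _ using hu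
  · have := le_of_ae_hasDerivAt_nonpos (g := fun t => -((t - c) * (1 - cdf D t) - l * t))
      (g' := fun t => -((1 - cdf D t) - (t - c) * f t - l)) h
      (hD.absolutelyContinuousOnInterval_shifted c l t p).fun_neg ?_
      (fun u hu => by linarith [h2 u hu])
    · linarith
    · filter_upwards [hD.ae_hasDerivAt_shifted c l] with u hu _ using hu.fun_neg

end IsValueDistribution

/-! ### Supporting lines of the revenue curve under regularity and under DMR. -/

variable {D : Measure ℝ} {f : ℝ → ℝ}

theorem one_sub_cdf_nonneg (D : Measure ℝ) (t : ℝ) : 0 ≤ 1 - cdf D t :=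
  sub_nonneg.2 (cdf_le_one D t)

theorem IsMyersonPrice.revenueCurve_le {vM t : ℝ} (h : IsMyersonPrice D vM) (ht : 0 ≤ t) :
    revenueCurve D t ≤ revenueCurve D vM := h.2 ht

theorem IsMyersonPrice.of_le {vM t : ℝ} (h : IsMyersonPrice D vM) (ht : 0 ≤ t)
    (hle : revenueCurve D vM ≤ revenueCurve D t) : IsMyersonPrice D t :=
  ⟨ht, fun _ hu => (h.revenueCurve_le hu).trans hle⟩

theorem virtualValue_of_pos {t : ℝ} (hf : 0 < f t) :
    virtualValue D f t = ((t - (1 - cdf D t) / f t : ℝ) : EReal) := by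
  rw [virtualValue, ← ENNReal.ofReal_div_of_pos hf, EReal.coe_ennreal_ofReal,
    max_eq_left (div_nonneg (one_sub_cdf_nonneg D t) hf.le), EReal.coe_sub]

theorem virtualValue_of_eq_zero {t : ℝ} (ht : t ∈ typeRange D) (hf : f t = 0) :
    virtualValue D f t = ⊥ := by
  have h : ENNReal.ofReal (1 - cdf D t) ≠ 0 := by
    have := ht.2
    simp only [ne_eq, ENNReal.ofReal_eq_zero]; linarith
  rw [virtualValue, hf, ENNReal.ofReal_zero, ENNReal.div_zero h]
  simp

theorem typeRange_of_le {t u : ℝ} (ht : t ∈ typeRange D) (hu : 0 ≤ u) (hut : u ≤ t) :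
    u ∈ typeRange D := ⟨hu, (monotone_cdf D hut).trans_lt ht.2⟩

/-- Under regularity, if the virtual value at `p` is `c`, then the price `p` maximizes
`(t - c) (1 - F t)`. -/
theorem IsRegular.shifted_le (hD : IsValueDistribution D f) (hreg : IsRegular D f) {p t : ℝ}
    (hp : p ∈ typeRange D) (hf : 0 < f p) (ht : t ∈ typeRange D) :
    (t - (p - (1 - cdf D p) / f p)) * (1 - cdf D t) ≤
      (p - (p - (1 - cdf D p) / f p)) * (1 - cdf D p) := by
  set c := p - (1 - cdf D p) / f p with hc
  have := hD.shifted_le_of_derivative_sign (c := c) (l := 0) (p := p) (t := t) ?_ ?_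
  · simpa using this
  · intro u hu
    have hur := typeRange_of_le ht (hp.1.trans hu.1) hu.2
    have hle := hreg hp hur hu.1
    rw [virtualValue_of_pos hf] at hle
    rcases (hD.nonneg u).eq_or_lt with h0 | h0
    · rw [virtualValue_of_eq_zero hur h0.symm] at hle
      exact absurd hle (not_le.2 (EReal.bot_lt_coe _))
    · rw [virtualValue_of_pos h0, EReal.coe_le_coe_iff, ← hc] at hle
      have : (1 - cdf D u) / f u ≤ u - c := by linarith
      rw [div_le_iff₀ h0] at this
      linarith
  · intro u hu
    rcases lt_or_ge u 0 with hu0 | hu0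
    · exact absurd hu0 (not_lt.2 (ht.1.trans hu.1))
    have hur := typeRange_of_le hp hu0 hu.2
    have hle := hreg hur hp hu.2
    rw [virtualValue_of_pos hf] at hle
    rcases (hD.nonneg u).eq_or_lt with h0 | h0
    · rw [← h0]; linarith [one_sub_cdf_nonneg D u]
    · rw [virtualValue_of_pos h0, EReal.coe_le_coe_iff, ← hc] at hle
      have : u - c ≤ (1 - cdf D u) / f u := by linarith
      rw [le_div_iff₀ h0] at this
      linarith

theorem cdf_zero (hD : IsValueDistribution D f) : cdf D 0 = 0 := by
  have := hD.isProbabilityMeasure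
  have := hD.nullSingletonClass
  rw [cdf_eq_real, Measure.real, ← measure_congr (Iio_ae_eq_Iic (μ := D) (a := (0 : ℝ))),
    hD.nonneg_values, ENNReal.toReal_zero]

/-- Regularity does not make the revenue curve concave, but a concave curve touches it from above at
`p`. With `c` the virtual value at `p`, `IsRegular.shifted_le` gives `1 - F t ≤ (p - c) (1 - F p) /
(t - c)`, and `t / (t - c)` is concave in `t` for `c ≤ 0`. The slope `l` is that of this upper curve
at `p`. -/
theorem IsRegular.exists_support (hD : IsValueDistribution D f) (hreg : IsRegular D f) {vM p : ℝ}
    (hvM : IsMyersonPrice D vM) (hpv : p ≤ vM) (hp : p ∈ typeRange D)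
    (hno : revenueCurve D p < revenueCurve D vM) :
    ∃ l, 0 ≤ l ∧ ∀ t, 0 ≤ t → revenueCurve D t ≤ revenueCurve D p + l * (t - p) := by
  rcases (hD.nonneg p).eq_or_lt with hf | hf
  -- Here the virtual value is `-∞` at `p`, hence on all of `[0, p]`. So there is no mass below `p`,
  -- and the line `R t ≤ t` is attained at `p`.
  · refine ⟨1, zero_le_one, fun t ht => ?_⟩
    have hz : cdf D p = 0 := by
      have h := hD.cdf_sub_cdf 0 p
      rw [cdf_zero hD, sub_zero] at h
      rw [h]
      refine (intervalIntegral.integral_congr fun u hu => ?_).trans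
        (intervalIntegral.integral_zero (a := 0) (b := p))
      rw [uIcc_of_le hp.1] at hu
      have hur := typeRange_of_le hp hu.1 hu.2
      have hle := hreg hur hp hu.2
      rw [virtualValue_of_eq_zero hp hf.symm] at hle
      by_contra hne
      rw [virtualValue_of_pos (lt_of_le_of_ne (hD.nonneg u) (Ne.symm hne))] at hle
      exact absurd hle (not_le.2 (EReal.bot_lt_coe _))
    simp only [revenueCurve, hz]
    nlinarith [cdf_nonneg D t]
  · have hFp : 0 < 1 - cdf D p := sub_pos.2 hp.2
    have hs : ∀ t, 0 ≤ t → (t - (p - (1 - cdf D p) / f p)) * (1 - cdf D t) ≤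
        (p - (p - (1 - cdf D p) / f p)) * (1 - cdf D p) := by
      intro t ht
      rcases lt_or_ge (cdf D t) 1 with h | h
      · exact hreg.shifted_le hD hp hf ⟨ht, h⟩
      · rw [le_antisymm (cdf_le_one D t) h]
        have : 0 < (1 - cdf D p) / f p := by positivity
        nlinarith
    have hcp : 0 < p - (p - (1 - cdf D p) / f p) := by
      have : 0 < (1 - cdf D p) / f p := by positivity
      linarith
    generalize p - (1 - cdf D p) / f p = c at hs hcp
    -- For `c > 0` the subtracted term `c (1 - F)` is at least as large at `p` as at `vM ≥ p`, so
    -- optimality of `p` for the shifted revenue would force `R vM ≤ R p`.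
    have hc : c ≤ 0 := by
      by_contra! hc
      have h1 := hs vM hvM.1
      have h2 := monotone_cdf D hpv
      simp only [revenueCurve] at hno
      nlinarith
    refine ⟨(1 - cdf D p) * (-c) / (p - c), by
      exact div_nonneg (mul_nonneg hFp.le (by linarith)) hcp.le, fun t ht => ?_⟩
    -- The point `0` is separate because `t - c` vanishes there when `c = 0`.
    rcases ht.eq_or_lt with rfl | ht'
    · simp only [revenueCurve, zero_mul, zero_sub]
      rw [div_mul_eq_mul_div, ← sub_nonneg]
      have : p * (1 - cdf D p) + (1 - cdf D p) * -c * -p / (p - c) - 0 =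
        (1 - cdf D p) * p ^ 2 / (p - c) := by field_simp; ring
      rw [this]; positivity
    have htc : 0 < t - c := by linarith
    have h1 : 1 - cdf D t ≤ (p - c) * (1 - cdf D p) / (t - c) := by
      rw [le_div_iff₀ htc]; linarith [hs t ht]
    have h2 : t * (1 - cdf D t) ≤ t * ((p - c) * (1 - cdf D p) / (t - c)) := by gcongr
    simp only [revenueCurve]
    refine h2.trans ?_
    rw [← sub_nonneg]
    have : p * (1 - cdf D p) + (1 - cdf D p) * -c / (p - c) * (t - p) -
        t * ((p - c) * (1 - cdf D p) / (t - c)) =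
        (1 - cdf D p) * (-c) * (t - p) ^ 2 / ((p - c) * (t - c)) := by
      field_simp; ring
    rw [this]
    exact div_nonneg (mul_nonneg (mul_nonneg hFp.le (by linarith)) (sq_nonneg _)) (by positivity)

/-- The derivative of the revenue curve is almost everywhere `(1 - F t) - t f t`, so DMR is
concavity on the type range and `l` is the slope at `p`. A negative slope would contradict `R p < R
vM`; a nonnegative one extends the bound beyond the range, where the revenue is `0`. -/
theorem IsDMR.exists_support (hD : IsValueDistribution D f) (hreg : IsDMR D f) {vM p : ℝ}
    (hvM : IsMyersonPrice D vM) (hpv : p ≤ vM) (hp : p ∈ typeRange D)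
    (hno : revenueCurve D p < revenueCurve D vM) :
    ∃ l, 0 ≤ l ∧ ∀ t, 0 ≤ t → revenueCurve D t ≤ revenueCurve D p + l * (t - p) := by
  set l := -(p * f p - (1 - cdf D p)) with hl
  have hs : ∀ t ∈ typeRange D, revenueCurve D t ≤ revenueCurve D p + l * (t - p) := by
    intro t ht
    have := hD.shifted_le_of_derivative_sign (c := 0) (l := l) (p := p) (t := t) ?_ ?_
    · simp only [sub_zero] at this
      simp only [revenueCurve]; linarith
    · intro u hu
      have := hreg hp (typeRange_of_le ht (hp.1.trans hu.1) hu.2) hu.1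
      simp only at this
      rw [sub_zero]; linarith
    · intro u hu
      have := hreg (typeRange_of_le hp (ht.1.trans hu.1) hu.2) hp hu.2
      simp only at this
      rw [sub_zero]; linarith
  have hl0 : 0 ≤ l := by
    by_contra! hneg
    rcases lt_or_ge (cdf D vM) 1 with h | h
    · have := hs vM ⟨hvM.1, h⟩
      nlinarith
    · have h0 : revenueCurve D vM = 0 := by
        rw [revenueCurve, le_antisymm (cdf_le_one D vM) h]; simp
      have : 0 ≤ revenueCurve D p := mul_nonneg hp.1 (one_sub_cdf_nonneg D p)
      linarith
  refine ⟨l, hl0, fun t ht => ?_⟩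
  rcases lt_or_ge (cdf D t) 1 with h | h
  · exact hs t ⟨ht, h⟩
  · have h0 : revenueCurve D t = 0 := by
      rw [revenueCurve, le_antisymm (cdf_le_one D t) h]; simp
    have hpt : p ≤ t := by
      by_contra! hlt
      exact absurd (monotone_cdf D hlt.le) (not_le.2 (hp.2.trans_le h))
    have : 0 ≤ revenueCurve D p := mul_nonneg hp.1 (one_sub_cdf_nonneg D p)
    rw [h0]
    exact add_nonneg this (mul_nonneg hl0 (sub_nonneg.2 hpt))

/-- Unless a price `q ≤ p` is optimal for a monopolist, the revenue curve has a supporting line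
of nonnegative slope at `p`. -/
theorem exists_support_of_no_myersonPrice_le (hD : IsValueDistribution D f)
    (hreg : IsRegular D f ∨ IsDMR D f) {vM p : ℝ} (hvM : IsMyersonPrice D vM) (hp : 0 ≤ p)
    (hno : ∀ q, q ≤ p → ¬ IsMyersonPrice D q) :
    ∃ l, 0 ≤ l ∧ ∀ t, 0 ≤ t → revenueCurve D t ≤ revenueCurve D p + l * (t - p) := by
  have hpv : p < vM := by
    by_contra! h
    exact hno vM h hvM
  have hlt : revenueCurve D p < revenueCurve D vM := by
    by_contra! h
    exact hno p le_rfl (hvM.of_le hp h)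
  have hpr : p ∈ typeRange D := by
    refine ⟨hp, ?_⟩
    by_contra! h
    refine hno 0 hp (hvM.of_le le_rfl ?_)
    have : cdf D vM = 1 := le_antisymm (cdf_le_one D vM) (h.trans (monotone_cdf D hpv.le))
    simp [revenueCurve, this]
  rcases hreg with h | h
  · exact h.exists_support hD hvM hpv.le hpr hlt
  · exact h.exists_support hD hvM hpv.le hpr hlt

/-! ### Effective values -/

/-- The value of the good that a buyer of type `v` expects when Bob is approached first and the
lottery `(z, p)` of Alice is available as an outside option. -/
def effectiveValue (z p v : ℝ) : ℝ := v - z * max (v - p) 0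

theorem continuous_effectiveValue (z p : ℝ) : Continuous (effectiveValue z p) := by
  unfold effectiveValue; fun_prop

theorem effectiveValue_of_le {z p v : ℝ} (h : v ≤ p) : effectiveValue z p v = v := by
  rw [effectiveValue, max_eq_right (by linarith)]; ring

theorem effectiveValue_of_ge {z p v : ℝ} (h : p ≤ v) :
    effectiveValue z p v = (1 - z) * v + z * p := by
  rw [effectiveValue, max_eq_left (by linarith)]; ring

theorem effectiveValue_nonneg {z p v : ℝ} (hz : z ∈ Icc (0 : ℝ) 1) (hp : 0 ≤ p) (hv : 0 ≤ v) :
    0 ≤ effectiveValue z p v := by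
  rcases le_total v p with h | h
  · rwa [effectiveValue_of_le h]
  · rw [effectiveValue_of_ge h]
    exact add_nonneg (mul_nonneg (by linarith [hz.2]) hv) (mul_nonneg hz.1 hp)

/-- Effective values are weakly increasing in the type, so a tail of effective values is controlled
by a tail of types, `t` being the type with effective value `s`. For `z = 1` no effective value
exceeds `p`, which gives the null alternative. -/
theorem effectiveValue_tail (hD : IsValueDistribution D f) {z p s : ℝ} (hz : z ∈ Icc (0 : ℝ) 1) :
    D {v | s ≤ effectiveValue z p v} = 0 ∨
      ∃ t, D {v | s ≤ effectiveValue z p v} ≤ ENNReal.ofReal (1 - cdf D t) ∧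
        ((s ≤ p ∧ t = s) ∨ (p ≤ t ∧ s = (1 - z) * t + z * p)) := by
  rcases le_or_gt s p with hs | hs
  · refine Or.inr ⟨s, ?_, Or.inl ⟨hs, rfl⟩⟩
    rw [← hD.measure_Ici]
    refine measure_mono fun v (hv : s ≤ _) => ?_
    have : 0 ≤ z * max (v - p) 0 := mul_nonneg hz.1 (le_max_right _ _)
    simp only [effectiveValue] at hv
    exact mem_Ici.2 (by linarith)
  have key : ∀ v, s ≤ effectiveValue z p v → p ≤ v ∧ s ≤ (1 - z) * v + z * p := by
    intro v hv
    rcases le_total v p with h | h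
    · rw [effectiveValue_of_le h] at hv; linarith
    · rw [effectiveValue_of_ge h] at hv; exact ⟨h, hv⟩
  rcases hz.2.eq_or_lt with rfl | hz1
  · left
    have : {v | s ≤ effectiveValue 1 p v} = ∅ := by
      ext v
      simp only [mem_ofPred_eq, mem_empty_iff_false, iff_false]
      intro hv
      have := (key v hv).2
      linarith
    rw [this, measure_empty]
  · have h1 : 0 < 1 - z := by linarith
    refine Or.inr ⟨(s - z * p) / (1 - z), ?_, Or.inr ⟨?_, by field_simp; ring⟩⟩
    · rw [← hD.measure_Ici]
      refine measure_mono fun v hv => ?_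
      rw [mem_Ici, div_le_iff₀ h1]
      linarith [(key v hv).2]
    · rw [le_div_iff₀ h1]; linarith

/-- Effective values are at most values, so they do not raise the monopolist revenue. -/
theorem mul_effectiveValue_tail_le (hD : IsValueDistribution D f) {z p s vM : ℝ}
    (hz : z ∈ Icc (0 : ℝ) 1) (hvM : IsMyersonPrice D vM) (hp : 0 ≤ p) (hs : 0 ≤ s) :
    ENNReal.ofReal s * D {v | s ≤ effectiveValue z p v} ≤ ENNReal.ofReal (revenueCurve D vM) := by
  rcases effectiveValue_tail hD (p := p) (s := s) hz with h | ⟨t, ht, h⟩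
  · simp [h]
  grw [ht]
  rw [← ENNReal.ofReal_mul hs]
  apply ENNReal.ofReal_le_ofReal
  have hFt := one_sub_cdf_nonneg D t
  rcases h with ⟨_, rfl⟩ | ⟨h1, rfl⟩
  · exact hvM.revenueCurve_le hs
  · refine le_trans ?_ (hvM.revenueCurve_le (hp.trans h1))
    exact mul_le_mul_of_nonneg_right (by nlinarith [hz.1]) hFt

/-- For `t ≥ p` the product is `(1 - z) R t + z p (1 - F t)`. The supporting line bounds the first
term, `p (1 - F t) ≤ R p` bounds the second, and `s - p = (1 - z) (t - p)`. The bound is affine in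
`s` with nonnegative coefficients, so it can be integrated over levels in `ℝ≥0∞`. -/
theorem mul_effectiveValue_tail_le_support (hD : IsValueDistribution D f) {z p s l : ℝ}
    (hz : z ∈ Icc (0 : ℝ) 1) (hp : 0 ≤ p) (hs : 0 ≤ s) (hl : 0 ≤ l)
    (hsup : ∀ t, 0 ≤ t → revenueCurve D t ≤ revenueCurve D p + l * (t - p)) :
    ENNReal.ofReal s * D {v | s ≤ effectiveValue z p v} ≤
      ENNReal.ofReal (revenueCurve D p - l * p) + ENNReal.ofReal l * ENNReal.ofReal s := by
  have h0 : 0 ≤ revenueCurve D p - l * p := by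
    have := hsup 0 le_rfl
    simp only [revenueCurve, zero_mul, zero_sub] at this
    simp only [revenueCurve]; linarith
  rcases effectiveValue_tail hD (p := p) (s := s) hz with h | ⟨t, ht, h⟩
  · simp [h]
  grw [ht]
  rw [← ENNReal.ofReal_mul hs, ← ENNReal.ofReal_mul hl, ← ENNReal.ofReal_add h0 (by positivity)]
  apply ENNReal.ofReal_le_ofReal
  rcases h with ⟨_, rfl⟩ | ⟨h1, rfl⟩
  · have := hsup t hs
    simp only [revenueCurve] at this ⊢
    linarith
  · have h2 := hsup t (hp.trans h1)
    have h3 : z * p * (1 - cdf D t) ≤ z * p * (1 - cdf D p) :=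
      mul_le_mul_of_nonneg_left (by linarith [monotone_cdf D h1]) (mul_nonneg hz.1 hp)
    have h4 := mul_le_mul_of_nonneg_left h2 (sub_nonneg.2 hz.2)
    simp only [revenueCurve] at h4 ⊢
    linarith

/-- When Alice comes first, `z p` per unit of the effective payment does not reach Bob. What remains
is `s - z p = (1 - z) t`, a monopoly price scaled by `1 - z`. -/
theorem mul_effectiveValue_tail_le_second (hD : IsValueDistribution D f) {z p s vM : ℝ}
    (hz : z ∈ Icc (0 : ℝ) 1) (hp : 0 ≤ p) (hs : p ≤ s) (hvM : IsMyersonPrice D vM) :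
    ENNReal.ofReal (s - z * p) * D {v | s ≤ effectiveValue z p v} ≤
      ENNReal.ofReal ((1 - z) * revenueCurve D vM) := by
  have h0 : 0 ≤ s - z * p := by nlinarith [hz.2]
  rcases effectiveValue_tail hD (p := p) (s := s) hz with h | ⟨t, ht, h⟩
  · simp [h]
  grw [ht]
  rw [← ENNReal.ofReal_mul h0]
  apply ENNReal.ofReal_le_ofReal
  have key : ∀ t, 0 ≤ t → (1 - z) * t * (1 - cdf D t) ≤ (1 - z) * revenueCurve D vM := by
    intro t ht
    rw [mul_assoc]
    exact mul_le_mul_of_nonneg_left (hvM.revenueCurve_le ht) (sub_nonneg.2 hz.2)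
  rcases h with ⟨h1, rfl⟩ | ⟨h1, rfl⟩
  · obtain rfl : t = p := le_antisymm h1 hs
    convert key t hp using 2
    ring
  · convert key t (hp.trans h1) using 2
    ring

/-! ### Existence of the buyer's choice -/

/-- A lexicographic maximum of three continuous functions exists on a nonempty compact set. -/
theorem exists_lex_max {α : Type*} [TopologicalSpace α] {K : Set α} (hK : IsCompact K)
    (hne : K.Nonempty) {g₁ g₂ g₃ : α → ℝ} (h₁ : ContinuousOn g₁ K) (h₂ : ContinuousOn g₂ K)
    (h₃ : ContinuousOn g₃ K) :
    ∃ a ∈ K, ∀ b ∈ K, g₁ b < g₁ a ∨ (g₁ b = g₁ a ∧ (g₂ b < g₂ a ∨ (g₂ b = g₂ a ∧ g₃ b ≤ g₃ a))) := by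
  have step : ∀ {K : Set α} {g : α → ℝ}, IsCompact K → ContinuousOn g K → ∀ {a}, a ∈ K →
      IsCompact {b ∈ K | g b = g a} := by
    intro K g hK hg a _
    have : {b ∈ K | g b = g a} = K ∩ g ⁻¹' {g a} := rfl
    rw [this]
    obtain ⟨u, hu, he⟩ := (continuousOn_iff_isClosed.1 hg) {g a} isClosed_singleton
    rw [inter_comm, he, inter_comm]
    exact hK.inter_right hu
  obtain ⟨a₁, ha₁, hm₁⟩ := hK.exists_isMaxOn hne h₁
  have hK₂ := step hK h₁ ha₁
  obtain ⟨a₂, ha₂, hm₂⟩ := hK₂.exists_isMaxOn ⟨a₁, ha₁, rfl⟩ (h₂.mono fun _ h => h.1)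
  have hK₃ := step hK₂ (h₂.mono fun _ h => h.1) ha₂
  obtain ⟨a₃, ha₃, hm₃⟩ := hK₃.exists_isMaxOn ⟨a₂, ha₂, rfl⟩ (h₃.mono fun _ h => h.1.1)
  refine ⟨a₃, ha₃.1.1, fun b hb => ?_⟩
  have e1 : g₁ a₃ = g₁ a₁ := ha₃.1.2
  have e2 : g₂ a₃ = g₂ a₂ := ha₃.2
  rcases (isMaxOn_iff.1 hm₁ b hb).lt_or_eq with h | h
  · exact Or.inl (e1 ▸ h)
  refine Or.inr ⟨h.trans e1.symm, ?_⟩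
  rcases (isMaxOn_iff.1 hm₂ b ⟨hb, h⟩).lt_or_eq with h' | h'
  · exact Or.inl (e2 ▸ h')
  · exact Or.inr ⟨h'.trans e2.symm, isMaxOn_iff.1 hm₃ b ⟨⟨hb, h⟩, h'⟩⟩

theorem singleLottery_ne_top_iff {z p x : ℝ} : singleLottery z p x ≠ ∞ ↔ x ≤ z := by
  unfold singleLottery; split_ifs with h <;> simp [h]

theorem singleLottery_of_le {z p x : ℝ} (h : x ≤ z) :
    singleLottery z p x = ENNReal.ofReal (p * x) := if_pos h

theorem toReal_singleLottery {z p x : ℝ} (hp : 0 ≤ p) (hx : 0 ≤ x) (h : x ≤ z) :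
    (singleLottery z p x).toReal = p * x := by
  rw [singleLottery_of_le h, ENNReal.toReal_ofReal (by positivity)]

theorem feasible_singleLottery_iff {z p : ℝ} (hz : z ≤ 1) {B : Pricing} {τ : Strategy} :
    Feasible (singleLottery z p) B τ ↔
      (0 ≤ τ.xA ∧ τ.xA ≤ z) ∧ ((0 ≤ τ.xB ∧ τ.xB ≤ 1) ∧ B τ.xB ≠ ∞) := by
  simp only [Feasible, singleLottery_ne_top_iff, mem_Icc]
  constructor
  · rintro ⟨⟨⟨a, _⟩, b⟩, c⟩; exact ⟨⟨a, b⟩, c⟩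
  · rintro ⟨⟨a, b⟩, c⟩; exact ⟨⟨⟨a, b.trans hz⟩, b⟩, c⟩

theorem le_maxProb {B : Pricing} {x : ℝ} (hx : x ∈ Icc (0 : ℝ) 1) (h : B x ≠ ∞) :
    x ≤ maxProb B :=
  le_csSup ⟨1, fun _ hy => hy.1.2⟩ ⟨hx, lt_top_iff_ne_top.2 h⟩

/-- The offers that a buyer of type `v` can accept without loss form a compact set. -/
theorem IsProper.isCompact_sublevel {B : Pricing} (hB : IsProper B) (v : ℝ) :
    IsCompact {x | x ∈ Icc (0 : ℝ) 1 ∧ B x ≤ ENNReal.ofReal v} := by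
  have h : {x | x ∈ Icc (0 : ℝ) 1 ∧ B x ≤ ENNReal.ofReal v} =
      Icc 0 1 ∩ (Icc 0 (maxProb B) ∩ B ⁻¹' Iic (ENNReal.ofReal v)) := by
    ext x
    constructor
    · rintro ⟨hx, hBx⟩
      exact ⟨hx, ⟨hx.1, le_maxProb hx (hBx.trans_lt ENNReal.ofReal_lt_top).ne⟩, hBx⟩
    · rintro ⟨hx, _, hBx⟩
      exact ⟨hx, hBx⟩
  rw [h]
  exact isCompact_Icc.inter_right (hB.continuousOn.preimage_isClosed_of_isClosed isClosed_Icc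
    isClosed_Iic)

theorem IsProper.continuousOn_toReal {B : Pricing} (hB : IsProper B) (v : ℝ) :
    ContinuousOn (fun x => (B x).toReal) {x | x ∈ Icc (0 : ℝ) 1 ∧ B x ≤ ENNReal.ofReal v} := by
  have hne : ∀ x ∈ {x | x ∈ Icc (0 : ℝ) 1 ∧ B x ≤ ENNReal.ofReal v}, B x ≠ ∞ :=
    fun x hx => (hx.2.trans_lt ENNReal.ofReal_lt_top).ne
  exact ENNReal.continuousOn_toReal.comp
    (hB.continuousOn.mono fun x hx => ⟨hx.1.1, le_maxProb hx.1 (hne x hx)⟩) hne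

theorem utility_singleLottery {z p v : ℝ} (hp : 0 ≤ p) {B : Pricing} {τ : Strategy}
    (h0 : 0 ≤ τ.xA) (hz : τ.xA ≤ z) :
    utility (singleLottery z p) B v τ = match τ.first with
      | .alice => τ.xA * (v - p) + (1 - τ.xA) * (τ.xB * v - (B τ.xB).toReal)
      | .bob => (τ.xB * v - (B τ.xB).toReal) + (1 - τ.xB) * (τ.xA * (v - p)) := by
  rcases τ with ⟨_ | _, xA, xB⟩ <;>
    simp only [utility, toReal_singleLottery hp h0 hz] <;> ring

/-- The feasible set need not be compact, since Bob's price may tend to infinity. The maximum is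
taken over offers priced at most `v`; dearer ones are never better than buying nothing from Bob. -/
theorem exists_isChoice {z p : ℝ} (hz : z ∈ Icc (0 : ℝ) 1) (hp : 0 ≤ p) {B : Pricing}
    (hB : IsProper B) {v : ℝ} (hv : 0 ≤ v) : ∃ σ, IsChoice (singleLottery z p) B v σ := by
  set A := singleLottery z p with hA
  let S : Set ℝ := {x | x ∈ Icc (0 : ℝ) 1 ∧ B x ≤ ENNReal.ofReal v}
  have hS0 : (0 : ℝ) ∈ S := ⟨⟨le_rfl, zero_le_one⟩, by rw [hB.map_zero]; exact zero_le⟩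
  let K : Set (ℝ × ℝ) := Icc 0 z ×ˢ S
  have hK : IsCompact K := isCompact_Icc.prod (hB.isCompact_sublevel v)
  have hKne : K.Nonempty := ⟨(0, 0), ⟨⟨le_rfl, hz.1⟩, hS0⟩⟩
  have hBc : ContinuousOn (fun q : ℝ × ℝ => (B q.2).toReal) K :=
    (hB.continuousOn_toReal v).comp continuousOn_snd fun q hq => hq.2
  have hfeas : ∀ (o : Seller) (q : ℝ × ℝ), q ∈ K → Feasible A B ⟨o, q.1, q.2⟩ := fun o q hq =>
    (feasible_singleLottery_iff hz.2).2
      ⟨hq.1, hq.2.1, (hq.2.2.trans_lt ENNReal.ofReal_lt_top).ne⟩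
  have hex : ∀ o : Seller, ∃ q ∈ K, ∀ r ∈ K,
      utility A B v ⟨o, r.1, r.2⟩ < utility A B v ⟨o, q.1, q.2⟩ ∨
      (utility A B v ⟨o, r.1, r.2⟩ = utility A B v ⟨o, q.1, q.2⟩ ∧
        (allocB ⟨o, r.1, r.2⟩ < allocB ⟨o, q.1, q.2⟩ ∨
          (allocB ⟨o, r.1, r.2⟩ = allocB ⟨o, q.1, q.2⟩ ∧
            allocA ⟨o, r.1, r.2⟩ ≤ allocA ⟨o, q.1, q.2⟩))) := by
    intro o
    refine exists_lex_max (g₁ := fun q : ℝ × ℝ => utility A B v ⟨o, q.1, q.2⟩)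
      (g₂ := fun q : ℝ × ℝ => allocB ⟨o, q.1, q.2⟩)
      (g₃ := fun q : ℝ × ℝ => allocA ⟨o, q.1, q.2⟩) hK hKne ?_ ?_ ?_
    · have hc : ContinuousOn (fun q : ℝ × ℝ => (match o with
          | .alice => q.1 * (v - p) + (1 - q.1) * (q.2 * v - (B q.2).toReal)
          | .bob => (q.2 * v - (B q.2).toReal) + (1 - q.2) * (q.1 * (v - p)) : ℝ)) K := by
        cases o <;> simp only <;> fun_prop
      refine hc.congr fun q hq => ?_
      exact utility_singleLottery hp hq.1.1 hq.1.2
    · cases o <;> simp only [allocB] <;> fun_prop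
    · cases o <;> simp only [allocA] <;> fun_prop
  obtain ⟨a, haK, ha⟩ := hex .alice
  obtain ⟨b, hbK, hb⟩ := hex .bob
  -- the lexicographic maximum over the compact part of the feasible set
  obtain ⟨σ, hσ, hmax⟩ : ∃ σ, Feasible A B σ ∧ ∀ (o : Seller) (r : ℝ × ℝ), r ∈ K →
      utility A B v ⟨o, r.1, r.2⟩ < utility A B v σ ∨
      (utility A B v ⟨o, r.1, r.2⟩ = utility A B v σ ∧
        (allocB ⟨o, r.1, r.2⟩ < allocB σ ∨
          (allocB ⟨o, r.1, r.2⟩ = allocB σ ∧ allocA ⟨o, r.1, r.2⟩ ≤ allocA σ))) := by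
    by_cases hcmp : utility A B v ⟨.alice, a.1, a.2⟩ < utility A B v ⟨.bob, b.1, b.2⟩ ∨
      (utility A B v ⟨.alice, a.1, a.2⟩ = utility A B v ⟨.bob, b.1, b.2⟩ ∧
        (allocB ⟨.alice, a.1, a.2⟩ < allocB ⟨.bob, b.1, b.2⟩ ∨
          (allocB ⟨.alice, a.1, a.2⟩ = allocB ⟨.bob, b.1, b.2⟩ ∧
            allocA ⟨.alice, a.1, a.2⟩ ≤ allocA ⟨.bob, b.1, b.2⟩)))
    · refine ⟨⟨.bob, b.1, b.2⟩, hfeas _ _ hbK, ?_⟩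
      rintro (_ | _) r hr
      · have := ha r hr; grind
      · exact hb r hr
    · refine ⟨⟨.alice, a.1, a.2⟩, hfeas _ _ haK, ?_⟩
      rintro (_ | _) r hr
      · exact ha r hr
      · have := hb r hr; grind
  refine ⟨σ, hσ, fun τ hτ => ?_⟩
  obtain ⟨o, xA, xB⟩ := τ
  obtain ⟨⟨hA0, hAz⟩, ⟨hB0, hB1⟩, hBt⟩ := (feasible_singleLottery_iff hz.2).1 hτ
  dsimp only at hA0 hAz hB0 hB1 hBt
  by_cases hle : B xB ≤ ENNReal.ofReal v
  · exact hmax o (xA, xB) ⟨⟨hA0, hAz⟩, ⟨⟨hB0, hB1⟩, hle⟩⟩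
  have hgt : v < (B xB).toReal := by
    rw [not_le, ENNReal.ofReal_lt_iff_lt_toReal hv hBt] at hle
    exact hle
  have hu : xB * v - (B xB).toReal < 0 := by nlinarith
  have hz1 := hz.2
  have h0 := hmax o (xA, 0) ⟨⟨hA0, hAz⟩, hS0⟩
  have h00 := hmax o (0, 0) ⟨⟨le_rfl, hz.1⟩, hS0⟩
  rw [utility_singleLottery hp hA0 hAz] at h0 ⊢
  rw [utility_singleLottery hp le_rfl hz.1] at h00
  have hB00 : (B 0).toReal = 0 := by rw [hB.map_zero]; rfl
  rcases o with _ | _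
  · simp only [hB00, allocA, allocB] at h0 ⊢
    -- If `xA = 1`, Bob is never reached, and the dear offer ties with `xB = 0` in every criterion.
    rcases (hAz.trans hz1).eq_or_lt with rfl | h1
    · simpa using h0
    · left
      have : (1 - xA) * (xB * v - (B xB).toReal) < 0 := mul_neg_of_pos_of_neg (by linarith) hu
      rcases h0 with h | h
      · linarith
      · linarith [h.1]
  · simp only [hB00] at h0 h00 ⊢
    left
    rcases le_total p v with hpv | hpv
    · have : (1 - xB) * (xA * (v - p)) ≤ xA * (v - p) := by
        have : 0 ≤ xB * (xA * (v - p)) :=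
          mul_nonneg hB0 (mul_nonneg hA0 (by linarith))
        linarith
      rcases h0 with h | h
      · linarith
      · linarith [h.1]
    · have : (1 - xB) * (xA * (v - p)) ≤ 0 :=
        mul_nonpos_of_nonneg_of_nonpos (by linarith)
          (mul_nonpos_of_nonneg_of_nonpos hA0 (by linarith))
      rcases h00 with h | h
      · linarith
      · linarith [h.1]

theorem isChoice_choice {z p : ℝ} (hz : z ∈ Icc (0 : ℝ) 1) (hp : 0 ≤ p) {B : Pricing}
    (hB : IsProper B) {v : ℝ} (hv : 0 ≤ v) :
    IsChoice (singleLottery z p) B v (choice (singleLottery z p) B v) := by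
  have h := exists_isChoice hz hp hB hv
  rw [choice, dif_pos h]
  exact h.choose_spec

/-! ### Properties of the buyer's choice -/

theorem IsChoice.utility_le {A B : Pricing} {v : ℝ} {σ τ : Strategy} (h : IsChoice A B v σ)
    (hτ : Feasible A B τ) : utility A B v τ ≤ utility A B v σ := by
  rcases h.2 τ hτ with h | h
  · exact h.le
  · exact h.1.le

/-- The price that a buyer with an effective value faces: the cost of approaching Bob first, or
that of approaching Bob after Alice, whichever is smaller. -/
def effectivePrice (z p x b : ℝ) : ℝ := min b (z * p * x + (1 - z) * b)

/-- After subtracting the constant `z (v - p)⁺`, the utility of the best strategy buying `x` from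
Bob is compared with `s x` minus the effective price. Bounding the optimal utility from both sides
yields incentive compatibility, and the form of the upper bound records which order determines Bob's
payment. -/
theorem IsChoice.outcome {z p : ℝ} (hz : z ∈ Icc (0 : ℝ) 1) (hp : 0 ≤ p) {B : Pricing}
    (hB : IsProper B) {v : ℝ} {σ : Strategy}
    (h : IsChoice (singleLottery z p) B v σ) :
    (∀ x, 0 ≤ x → x ≤ 1 → B x ≠ ∞ →
      effectiveValue z p v * x - effectivePrice z p x (B x).toReal ≤
        effectiveValue z p v * σ.xB - effectivePrice z p σ.xB (B σ.xB).toReal) ∧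
    (((B σ.xB).toReal ≤ p * σ.xB ∧ payB B σ ≤ B σ.xB) ∨
      (p * σ.xB ≤ (B σ.xB).toReal ∧ p ≤ v ∧ payB B σ ≤ ENNReal.ofReal (1 - z) * B σ.xB)) := by
  have hz0 := hz.1
  have hz1 := hz.2
  obtain ⟨⟨hA0, hAz⟩, ⟨hB0, hB1⟩, hBt⟩ := (feasible_singleLottery_iff hz.2).1 h.1
  set U := utility (singleLottery z p) B v σ with hU
  have alice : ∀ xA x, 0 ≤ xA → xA ≤ z → 0 ≤ x → x ≤ 1 → B x ≠ ∞ →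
      xA * (v - p) + (1 - xA) * (x * v - (B x).toReal) ≤ U := fun xA x h1 h2 h3 h4 h5 => by
    have := h.utility_le (τ := ⟨.alice, xA, x⟩)
      ((feasible_singleLottery_iff hz.2).2 ⟨⟨h1, h2⟩, ⟨h3, h4⟩, h5⟩)
    rwa [utility_singleLottery hp h1 h2] at this
  have bob : ∀ xA x, 0 ≤ xA → xA ≤ z → 0 ≤ x → x ≤ 1 → B x ≠ ∞ →
      (x * v - (B x).toReal) + (1 - x) * (xA * (v - p)) ≤ U := fun xA x h1 h2 h3 h4 h5 => by
    have := h.utility_le (τ := ⟨.bob, xA, x⟩)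
      ((feasible_singleLottery_iff hz.2).2 ⟨⟨h1, h2⟩, ⟨h3, h4⟩, h5⟩)
    rwa [utility_singleLottery hp h1 h2] at this
  have hUval : U = _ := utility_singleLottery (z := z) (v := v) hp hA0 hAz
  have hU0 : 0 ≤ U := by
    have := bob 0 0 le_rfl hz0 le_rfl zero_le_one (by rw [hB.map_zero]; simp)
    simpa [hB.map_zero] using this
  set s := effectiveValue z p v with hs
  -- lower bounds for the utility
  have lower : ∀ x, 0 ≤ x → x ≤ 1 → B x ≠ ∞ →
      z * max (v - p) 0 + (s * x - effectivePrice z p x (B x).toReal) ≤ U := by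
    intro x h0 h1 ht
    rcases le_total p v with hpv | hpv
    · have e1 := alice z x hz0 le_rfl h0 h1 ht
      have e2 := bob z x hz0 le_rfl h0 h1 ht
      rw [hs, effectiveValue_of_ge hpv, effectivePrice, max_eq_left (by linarith)]
      rcases min_choice ((B x).toReal) (z * p * x + (1 - z) * (B x).toReal) with e | e <;> rw [e]
      · linarith
      · linarith
    · have e2 := bob 0 x le_rfl hz0 h0 h1 ht
      rw [hs, effectiveValue_of_le hpv, effectivePrice, max_eq_right (by linarith)]
      -- A type below `p` has no use for Alice's lottery, but where the second branch of the minimum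
      -- is strictly smaller the offer costs more than `p x` and is worth less than buying nothing.
      rcases le_total ((B x).toReal) (z * p * x + (1 - z) * (B x).toReal) with e | e
      · rw [min_eq_left e]; linarith
      · rw [min_eq_right e]
        have : 0 ≤ (1 - z) * ((B x).toReal - p * x) ∨ z = 0 := by
          rcases hz0.eq_or_lt with h | h
          · exact Or.inr h.symm
          · left
            refine mul_nonneg (by linarith) ?_
            nlinarith
        rcases this with h | h
        · have : v * x ≤ p * x := by gcongr
          linarith
        · subst h; linarith
  -- the utility of the choice in terms of effective values
  have upper : ((B σ.xB).toReal ≤ p * σ.xB ∧ payB B σ ≤ B σ.xB ∧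
        U ≤ z * max (v - p) 0 + (s * σ.xB - (B σ.xB).toReal)) ∨
      (p * σ.xB ≤ (B σ.xB).toReal ∧ p ≤ v ∧ payB B σ ≤ ENNReal.ofReal (1 - z) * B σ.xB ∧
        U ≤ z * max (v - p) 0 + (s * σ.xB - (z * p * σ.xB + (1 - z) * (B σ.xB).toReal))) := by
    set x := σ.xB with hx
    set b := (B x).toReal with hb
    have first : ∀ {P : ℝ≥0∞}, P ≤ B x → U ≤ x * v - b + (1 - x) * (σ.xA * (v - p)) →
        (b ≤ p * x ∧ P ≤ B x ∧ U ≤ z * max (v - p) 0 + (s * x - b)) ∨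
        (p * x ≤ b ∧ p ≤ v ∧ P ≤ ENNReal.ofReal (1 - z) * B x ∧
          U ≤ z * max (v - p) 0 + (s * x - (z * p * x + (1 - z) * b))) := by
      intro P hP hUle
      have hU2 : U ≤ z * max (v - p) 0 + (s * x - b) := by
        have h1 : σ.xA * (v - p) ≤ z * max (v - p) 0 := by
          calc σ.xA * (v - p) ≤ σ.xA * max (v - p) 0 := by gcongr; exact le_max_left _ _
            _ ≤ z * max (v - p) 0 := by gcongr
        have h2 := mul_le_mul_of_nonneg_left h1 (sub_nonneg.2 hB1)
        rw [hs, effectiveValue]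
        linarith
      by_cases hbp : b ≤ p * x
      · exact Or.inl ⟨hbp, hP, hU2⟩
      push Not at hbp
      have hpv : p ≤ v := by
        by_contra! hlt
        rw [hs, effectiveValue_of_le hlt.le, max_eq_right (by linarith)] at hU2
        have : v * x ≤ p * x := by gcongr
        linarith
      -- When `b > p x`, approaching Alice first with the full lottery would gain `z (b - p x)`. For
      -- `z = 0` the two effective prices coincide.
      have hz00 : z = 0 := by
        by_contra hne
        have hzp : 0 < z := lt_of_le_of_ne hz0 (Ne.symm hne)
        have := alice z x hz0 le_rfl hB0 hB1 hBt
        rw [hs, effectiveValue_of_ge hpv, max_eq_left (by linarith)] at hU2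
        nlinarith
      refine Or.inr ⟨hbp.le, hpv, ?_, ?_⟩
      · rw [hz00]; simpa using hP
      · rw [hz00] at hU2 ⊢; linarith
    rcases hf : σ.first with _ | _
    · rw [hf] at hUval
      simp only at hUval
      have hpay : payB B σ = ENNReal.ofReal (1 - σ.xA) * B x := by simp [payB, hf, hx]
      have hpay1 : payB B σ ≤ B x := by
        rw [hpay]
        calc _ ≤ 1 * B x := by
              gcongr
              exact ENNReal.ofReal_le_one.2 (by linarith)
          _ = B x := one_mul _
      rcases hA0.eq_or_lt with h0 | h0
      · apply first hpay1
        rw [hUval, ← h0]; simp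
      -- Swapping the order while keeping both probabilities changes the utility by `xA (b - p x)`.
      have hbx : p * x ≤ b := by
        have := bob σ.xA x hA0 hAz hB0 hB1 hBt
        rw [hUval] at this
        have h3 : 0 ≤ σ.xA * (b - p * x) := by linarith
        linarith [nonneg_of_mul_nonneg_right h3 h0]
      have hu := alice 0 x le_rfl hz0 hB0 hB1 hBt
      have hu' : x * v - b ≤ v - p := by
        rw [hUval] at hu
        have h3 : 0 ≤ σ.xA * (v - p - (x * v - b)) := by linarith
        linarith [nonneg_of_mul_nonneg_right h3 h0]
      have hpv : p ≤ v := by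
        by_contra! hlt
        have : U = (x * v - b) + σ.xA * (v - p - (x * v - b)) := by rw [hUval]; ring
        nlinarith [hAz.trans hz1]
      -- With equality the buyer is indifferent about `xA`, so `xA = z` may fail; but then `b = p
      -- x`, and the cheap alternative applies.
      rcases hu'.eq_or_lt with he | hlt
      · have hbe : b = p * x := by nlinarith
        refine Or.inl ⟨hbe.le, hpay1, ?_⟩
        have hUe : U = x * v - b := by rw [hUval]; linear_combination (-σ.xA) * he
        rw [hUe, hs, effectiveValue]
        have : 0 ≤ z * max (v - p) 0 * (1 - x) :=
          mul_nonneg (mul_nonneg hz0 (le_max_right _ _)) (by linarith)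
        linarith
      · have hxz : σ.xA = z := by
          refine le_antisymm hAz ?_
          have := alice z x hz0 le_rfl hB0 hB1 hBt
          rw [hUval] at this
          by_contra! hlt2
          nlinarith
        refine Or.inr ⟨hbx, hpv, by rw [hpay, hxz], ?_⟩
        rw [hUval, hxz, hs, effectiveValue_of_ge hpv, max_eq_left (by linarith)]
        linarith
    · rw [hf] at hUval
      simp only at hUval
      apply first
      · simp [payB, hf, hx]
      · exact hUval.le
  constructor
  · intro x h0 h1 ht
    have hl := lower x h0 h1 ht
    rcases upper with ⟨_, _, hu⟩ | ⟨_, _, _, hu⟩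
    · have : effectivePrice z p σ.xB (B σ.xB).toReal ≤ (B σ.xB).toReal := min_le_left _ _
      linarith
    · have : effectivePrice z p σ.xB (B σ.xB).toReal ≤
        z * p * σ.xB + (1 - z) * (B σ.xB).toReal := min_le_right _ _
      linarith
  · rcases upper with ⟨h1, h2, _⟩ | ⟨h1, h2, h3, _⟩
    · exact Or.inl ⟨h1, h2⟩
    · exact Or.inr ⟨h1, h2, h3⟩

/-- A type `v ≥ p` that does not pay `p z` to Alice buys from Bob at an average price of at most
`p`. -/
theorem IsChoice.of_payA_lt {z p : ℝ} (hz : z ∈ Icc (0 : ℝ) 1) (hp : 0 ≤ p) {B : Pricing}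
    (hB : IsProper B) {v : ℝ} (hpv : p ≤ v) {σ : Strategy}
    (h : IsChoice (singleLottery z p) B v σ)
    (hpay : payA (singleLottery z p) σ < ENNReal.ofReal (p * z)) :
    0 < σ.xB ∧ (B σ.xB).toReal ≤ p * σ.xB := by
  have hz0 := hz.1
  have hz1 := hz.2
  obtain ⟨⟨hA0, hAz⟩, ⟨hB0, hB1⟩, hBt⟩ := (feasible_singleLottery_iff hz.2).1 h.1
  have hpz : 0 < p * z := by
    by_contra! hle
    rw [ENNReal.ofReal_of_nonpos hle] at hpay
    exact not_lt_zero hpay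
  have hzp : 0 < z := pos_of_mul_pos_right hpz hp
  have hUval := utility_singleLottery (z := z) (v := v) (B := B) hp hA0 hAz
  have hxA : σ.first = .alice ∨ σ.xB = 0 → σ.xA < z := by
    intro hor
    have : payA (singleLottery z p) σ = ENNReal.ofReal (p * σ.xA) := by
      rcases hf : σ.first with _ | _
      · simp [payA, hf, singleLottery_of_le hAz]
      · rcases hor with h | h
        · rw [hf] at h; cases h
        · simp [payA, hf, h, singleLottery_of_le hAz]
    rw [this, ENNReal.ofReal_lt_ofReal_iff hpz] at hpay
    exact lt_of_mul_lt_mul_left hpay hp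
  constructor
  · by_contra! hle
    have hx0 : σ.xB = 0 := le_antisymm hle hB0
    have hlt := hxA (Or.inr hx0)
    have hU : utility (singleLottery z p) B v σ = σ.xA * (v - p) := by
      rw [hUval, hx0]
      rcases σ.first with _ | _ <;> simp [hB.map_zero]
    -- At `v = p` the utilities tie, and only the tie-breaking towards Alice excludes `xB = 0`.
    have hτ := h.2 ⟨.alice, z, 0⟩
      ((feasible_singleLottery_iff hz.2).2 ⟨⟨hz0, le_rfl⟩, ⟨le_rfl, zero_le_one⟩, by
        rw [hB.map_zero]; simp⟩)
    rw [hU, utility_singleLottery (z := z) (τ := ⟨.alice, z, 0⟩) hp hz0 le_rfl] at hτ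
    have eA : allocA σ = σ.xA := by
      rcases hf : σ.first with _ | _ <;> simp [allocA, hf, hx0]
    have eB : allocB σ = 0 := by
      rcases hf : σ.first with _ | _ <;> simp [allocB, hf, hx0]
    rw [eA, eB] at hτ
    have e1 : allocA ⟨.alice, z, 0⟩ = z := rfl
    have e2 : allocB ⟨.alice, z, 0⟩ = 0 := by simp [allocB]
    rw [e1, e2] at hτ
    simp only [hB.map_zero, ENNReal.toReal_zero, zero_mul, sub_zero, mul_zero, add_zero,
      lt_irrefl, false_or, true_and] at hτ
    rcases hτ with h | h
    · nlinarith
    · linarith [h.2]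
  · by_contra! hgt
    have hτ := h.utility_le (τ := ⟨.alice, z, σ.xB⟩)
      ((feasible_singleLottery_iff hz.2).2 ⟨⟨hz0, le_rfl⟩, ⟨hB0, hB1⟩, hBt⟩)
    rw [utility_singleLottery (z := z) (τ := ⟨.alice, z, σ.xB⟩) hp hz0 le_rfl, hUval] at hτ
    rcases hf : σ.first with _ | _
    · rw [hf] at hτ
      simp only at hτ
      have hlt := hxA (Or.inl hf)
      have : σ.xB * v - (B σ.xB).toReal < v - p := by nlinarith
      nlinarith
    · rw [hf] at hτ
      simp only at hτ
      have : σ.xA * (v - p) ≤ z * (v - p) := mul_le_mul_of_nonneg_right hAz (by linarith)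
      nlinarith

/-! ### Fixed prices -/

theorem fixedPrice_ne_top (q x : ℝ) : fixedPrice q x ≠ ∞ := ENNReal.ofReal_ne_top

theorem maxProb_fixedPrice (q : ℝ) : maxProb (fixedPrice q) = 1 := by
  have : {x | x ∈ Icc (0 : ℝ) 1 ∧ fixedPrice q x < ∞} = Icc 0 1 := by
    ext x
    simp [lt_top_iff_ne_top, fixedPrice_ne_top]
  rw [maxProb, this, csSup_Icc zero_le_one]

theorem isProper_fixedPrice {q : ℝ} (hq : 0 ≤ q) : IsProper (fixedPrice q) where
  map_zero := by simp [fixedPrice]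
  monotoneOn := fun x _ y _ hxy => ENNReal.ofReal_le_ofReal (by gcongr)
  continuousOn := (ENNReal.continuous_ofReal.comp (by fun_prop)).continuousOn
  convex := by
    rw [maxProb_fixedPrice]
    intro x hx y hy t ht
    have h1 : 0 ≤ q * x := mul_nonneg hq hx.1
    have h2 : 0 ≤ q * y := mul_nonneg hq hy.1
    have h3 : 0 ≤ 1 - t := by linarith [ht.2]
    simp only [fixedPrice]
    rw [← ENNReal.ofReal_mul ht.1, ← ENNReal.ofReal_mul h3,
      ← ENNReal.ofReal_add (mul_nonneg ht.1 h1) (mul_nonneg h3 h2)]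
    exact ENNReal.ofReal_le_ofReal (le_of_eq (by ring))

theorem payB_fixedPrice {q : ℝ} {σ : Strategy} (h1 : σ.xA ≤ 1) :
    payB (fixedPrice q) σ = ENNReal.ofReal (q * allocB σ) := by
  rcases hf : σ.first with _ | _
  · simp only [payB, allocB, hf, fixedPrice]
    rw [← ENNReal.ofReal_mul (by linarith)]
    congr 1; ring
  · simp only [payB, allocB, hf, fixedPrice]

/-- If a strategy is optimal for type `v`, then a lower bound for the payment to Bob is obtained
from its expected allocation. -/
theorem IsChoice.payB_fixedPrice_ge {z p q v : ℝ} (hz : z ∈ Icc (0 : ℝ) 1) (hq : 0 ≤ q)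
    {σ τ : Strategy} (h : IsChoice (singleLottery z p) (fixedPrice q) v σ)
    (hτ : Feasible (singleLottery z p) (fixedPrice q) τ)
    (hle : utility (singleLottery z p) (fixedPrice q) v σ ≤
      utility (singleLottery z p) (fixedPrice q) v τ) :
    ENNReal.ofReal (q * allocB τ) ≤ payB (fixedPrice q) σ := by
  obtain ⟨⟨hA0, hAz⟩, -⟩ := (feasible_singleLottery_iff hz.2).1 h.1
  rw [payB_fixedPrice (hAz.trans hz.2)]
  have : allocB τ ≤ allocB σ := by
    rcases h.2 τ hτ with h | ⟨_, h | h⟩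
    · exact absurd hle (not_le.2 h)
    · exact h.le
    · exact h.1.le
  exact ENNReal.ofReal_le_ofReal (by gcongr)

theorem toReal_fixedPrice {q x : ℝ} (hq : 0 ≤ q) (hx : 0 ≤ x) : (fixedPrice q x).toReal = q * x :=
  ENNReal.toReal_ofReal (mul_nonneg hq hx)

/-- At a price not above Alice's, buying outright from Bob is optimal, and ties are broken towards
Bob. -/
theorem payB_fixedPrice_of_le {z p q v : ℝ} (hz : z ∈ Icc (0 : ℝ) 1) (hq : 0 ≤ q) (hqp : q ≤ p)
    (hv : q ≤ v) :
    ENNReal.ofReal q ≤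
      payB (fixedPrice q) (choice (singleLottery z p) (fixedPrice q) v) := by
  have hp := hq.trans hqp
  have h := isChoice_choice hz hp (isProper_fixedPrice hq) (hq.trans hv)
  obtain ⟨⟨hA0, hAz⟩, ⟨hB0, hB1⟩, -⟩ := (feasible_singleLottery_iff hz.2).1 h.1
  have := h.payB_fixedPrice_ge hz hq (τ := ⟨.bob, 0, 1⟩)
    ((feasible_singleLottery_iff hz.2).2
      ⟨⟨le_rfl, hz.1⟩, ⟨zero_le_one, le_rfl⟩, fixedPrice_ne_top _ _⟩) ?_
  · simpa [allocB] using this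
  · rw [utility_singleLottery (z := z) (τ := ⟨.bob, 0, 1⟩) hp le_rfl hz.1,
      utility_singleLottery hp hA0 hAz]
    set σ := choice (singleLottery z p) (fixedPrice q) v
    have hA1 := hAz.trans hz.2
    rw [toReal_fixedPrice hq hB0]
    have e1 : σ.xB * (v - q) ≤ 1 * (v - q) := by gcongr
    have e2 : σ.xA * (v - p) ≤ σ.xA * (v - q) := by gcongr
    have e3 : σ.xA * (v - q) ≤ 1 * (v - q) := by gcongr
    simp only [toReal_fixedPrice hq zero_le_one]
    rcases σ.first with _ | _
    · have := mul_le_mul_of_nonneg_left e1 (sub_nonneg.2 hA1)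
      simp only; linarith
    · have := mul_le_mul_of_nonneg_left (e2.trans e3) (sub_nonneg.2 hB1)
      simp only; linarith

/-- At a price not below Alice's, it is optimal to try her full lottery first; Bob is reached with
the remaining probability `1 - z`. -/
theorem payB_fixedPrice_of_ge {z p q v : ℝ} (hz : z ∈ Icc (0 : ℝ) 1) (hp : 0 ≤ p) (hpq : p ≤ q)
    (hv : q ≤ v) :
    ENNReal.ofReal (q * (1 - z)) ≤
      payB (fixedPrice q) (choice (singleLottery z p) (fixedPrice q) v) := by
  have hq := hp.trans hpq
  have h := isChoice_choice hz hp (isProper_fixedPrice hq) (hq.trans hv)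
  obtain ⟨⟨hA0, hAz⟩, ⟨hB0, hB1⟩, -⟩ := (feasible_singleLottery_iff hz.2).1 h.1
  have := h.payB_fixedPrice_ge hz hq (τ := ⟨.alice, z, 1⟩)
    ((feasible_singleLottery_iff hz.2).2
      ⟨⟨hz.1, le_rfl⟩, ⟨zero_le_one, le_rfl⟩, fixedPrice_ne_top _ _⟩) ?_
  · simpa [allocB] using this
  · rw [utility_singleLottery (z := z) (τ := ⟨.alice, z, 1⟩) hp hz.1 le_rfl,
      utility_singleLottery hp hA0 hAz]
    set σ := choice (singleLottery z p) (fixedPrice q) v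
    have hA1 := hAz.trans hz.2
    rw [toReal_fixedPrice hq hB0]
    simp only [toReal_fixedPrice hq zero_le_one]
    rcases σ.first with _ | _
    · have e1 : σ.xB * (v - q) ≤ 1 * (v - q) := by gcongr
      have e2 := mul_le_mul_of_nonneg_left e1 (sub_nonneg.2 hA1)
      have e3 : σ.xA * (q - p) ≤ z * (q - p) := by gcongr
      simp only; linarith
    · have e1 : σ.xA * (v - p) ≤ z * (v - p) := by gcongr; linarith
      have e2 := mul_le_mul_of_nonneg_left e1 (sub_nonneg.2 hB1)
      have e3 : 0 ≤ σ.xB * z * (q - p) := mul_nonneg (mul_nonneg hB0 hz.1) (by linarith)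
      have e4 : 0 ≤ (1 - σ.xB) * (1 - z) * (v - q) :=
        mul_nonneg (mul_nonneg (by linarith) (by linarith [hz.2])) (by linarith)
      simp only; linarith

theorem le_revB_of_le_payB {D : Measure ℝ} {f : ℝ → ℝ} (hD : IsValueDistribution D f)
    {A B : Pricing} {q r : ℝ} (hr : 0 ≤ r)
    (h : ∀ v, q ≤ v → ENNReal.ofReal r ≤ payB B (choice A B v)) :
    ENNReal.ofReal (r * (1 - cdf D q)) ≤ revB A B D := by
  rw [ENNReal.ofReal_mul hr, ← hD.measure_Ici, ← lintegral_indicator_const measurableSet_Ici]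
  refine lintegral_mono fun v => ?_
  by_cases hv : v ∈ Ici q
  · rw [indicator_of_mem hv]; exact h v hv
  · rw [indicator_of_notMem hv]; exact zero_le

theorem revenueCurve_le_revB {D : Measure ℝ} {f : ℝ → ℝ} (hD : IsValueDistribution D f)
    {z p q : ℝ} (hz : z ∈ Icc (0 : ℝ) 1) (hq : 0 ≤ q) (hqp : q ≤ p) :
    ENNReal.ofReal (revenueCurve D q) ≤ revB (singleLottery z p) (fixedPrice q) D :=
  le_revB_of_le_payB hD hq fun _ hv => payB_fixedPrice_of_le hz hq hqp hv

theorem mul_revenueCurve_le_revB {D : Measure ℝ} {f : ℝ → ℝ} (hD : IsValueDistribution D f)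
    {z p q : ℝ} (hz : z ∈ Icc (0 : ℝ) 1) (hp : 0 ≤ p) (hpq : p ≤ q) :
    ENNReal.ofReal ((1 - z) * revenueCurve D q) ≤ revB (singleLottery z p) (fixedPrice q) D := by
  have := le_revB_of_le_payB hD (mul_nonneg (hp.trans hpq) (sub_nonneg.2 hz.2))
    fun _ hv => payB_fixedPrice_of_ge hz hp hpq hv
  convert this using 2
  rw [revenueCurve]; ring

/-! ### The integral representation of incentive compatible payments -/

/-- The least effective value at which at least the probability `y` is bought. -/
noncomputable def levelPrice (s x : ℝ → ℝ) (y : ℝ) : ℝ≥0∞ :=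
  ⨅ v, ⨅ (_ : 0 ≤ v ∧ y ≤ x v), ENNReal.ofReal (s v)

theorem monotone_levelPrice (s x : ℝ → ℝ) : Monotone (levelPrice s x) := fun _ _ hy =>
  le_iInf₂ fun v hv => iInf₂_le_of_le v ⟨hv.1, hy.trans hv.2⟩ le_rfl

theorem levelPrice_le {s x : ℝ → ℝ} {v y : ℝ} (hv : 0 ≤ v) (hy : y ≤ x v) :
    levelPrice s x y ≤ ENNReal.ofReal (s v) := iInf₂_le_of_le v ⟨hv, hy⟩ le_rfl

/-- Payments `c` and allocations `x` of the types `v ≥ 0` are incentive compatible for the values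
`s`. -/
structure IncentiveCompatible (s x c : ℝ → ℝ) : Prop where
  continuous : Continuous s
  zero : s 0 = 0
  nonneg : ∀ v, 0 ≤ v → 0 ≤ s v
  alloc_mem : ∀ v, 0 ≤ v → x v ∈ Icc (0 : ℝ) 1
  pay_nonneg : ∀ v, 0 ≤ v → 0 ≤ c v
  pay_zero : c 0 = 0
  le : ∀ v w, 0 ≤ v → 0 ≤ w → s v * x w - c w ≤ s v * x v - c v

namespace IncentiveCompatible

variable {s x c : ℝ → ℝ}

theorem alloc_le (h : IncentiveCompatible s x c) {v w : ℝ} (hv : 0 ≤ v) (hw : 0 ≤ w)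
    (hs : s v < s w) : x v ≤ x w := by
  have h1 := h.le v w hv hw
  have h2 := h.le w v hw hv
  by_contra! hlt
  nlinarith

theorem le_levelPrice (h : IncentiveCompatible s x c) {v y : ℝ} (hv : 0 ≤ v) (hy : x v < y) :
    ENNReal.ofReal (s v) ≤ levelPrice s x y := by
  refine le_iInf₂ fun w hw => ENNReal.ofReal_le_ofReal ?_
  by_contra! hlt
  exact absurd (h.alloc_le hw.1 hv hlt) (not_le.2 (hy.trans_le hw.2))

theorem lintegral_levelPrice_le (h : IncentiveCompatible s x c) {v : ℝ} (hv : 0 ≤ v) (a : ℝ) :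
    ∫⁻ y in Ioc a (x v), levelPrice s x y ≤ ENNReal.ofReal (s v * (x v - a)) := by
  calc ∫⁻ y in Ioc a (x v), levelPrice s x y
      ≤ ∫⁻ _ in Ioc a (x v), ENNReal.ofReal (s v) :=
        setLIntegral_mono measurable_const fun y hy => levelPrice_le hv hy.2
    _ = _ := by rw [setLIntegral_const, Real.volume_Ioc, ENNReal.ofReal_mul (h.nonneg v hv)]

theorem le_lintegral_levelPrice (h : IncentiveCompatible s x c) {v : ℝ} (hv : 0 ≤ v) (b : ℝ) :
    ENNReal.ofReal (s v * (b - x v)) ≤ ∫⁻ y in Ioc (x v) b, levelPrice s x y := by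
  calc _ = ∫⁻ _ in Ioc (x v) b, ENNReal.ofReal (s v) := by
        rw [setLIntegral_const, Real.volume_Ioc, ENNReal.ofReal_mul (h.nonneg v hv)]
    _ ≤ _ := setLIntegral_mono (monotone_levelPrice s x).measurable
        fun y hy => h.le_levelPrice hv hy.1

theorem lintegral_levelPrice_ne_top (h : IncentiveCompatible s x c) {v : ℝ} (hv : 0 ≤ v) (a : ℝ) :
    ∫⁻ y in Ioc a (x v), levelPrice s x y ≠ ∞ :=
  ((h.lintegral_levelPrice_le hv a).trans_lt ENNReal.ofReal_lt_top).ne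

/-- Induction along types with effective values `0, d, 2d, …`, which exist by continuity of `s`.
Between neighbours `v`, `w`, both the integral and the payment difference lie between `s v (x w - x
v)` and `s w (x w - x v)`. They differ by at most `d (x w - x v)`, and these errors telescope. -/
theorem abs_integral_sub_pay_le (h : IncentiveCompatible s x c) {d : ℝ} (hd : 0 < d) (n : ℕ) :
    ∀ v, 0 ≤ v → s v = n * d →
      |(∫⁻ y in Ioc 0 (x v), levelPrice s x y).toReal - c v| ≤ d * x v := by
  induction n with
  | zero =>
    intro v hv hs
    rw [Nat.cast_zero, zero_mul] at hs
    have h1 := h.lintegral_levelPrice_le hv 0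
    rw [hs, zero_mul, ENNReal.ofReal_zero, nonpos_iff_eq_zero] at h1
    have h2 := h.le v 0 hv le_rfl
    rw [hs, h.pay_zero] at h2
    have h3 : c v = 0 := le_antisymm (by linarith) (h.pay_nonneg v hv)
    rw [h1, h3]
    simpa using mul_nonneg hd.le (h.alloc_mem v hv).1
  | succ n ih =>
    intro w hw hs
    obtain ⟨v, ⟨hv, -⟩, hsv⟩ : (n * d : ℝ) ∈ s '' Icc 0 w := by
      refine intermediate_value_Icc hw h.continuous.continuousOn ⟨?_, ?_⟩
      · rw [h.zero]; positivity
      · rw [hs]; push_cast; nlinarith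
    have hlt : s v < s w := by rw [hsv, hs]; push_cast; nlinarith
    have hx := h.alloc_le hv hw hlt
    have hadd : (∫⁻ y in Ioc 0 (x w), levelPrice s x y).toReal =
        (∫⁻ y in Ioc 0 (x v), levelPrice s x y).toReal +
        (∫⁻ y in Ioc (x v) (x w), levelPrice s x y).toReal := by
      rw [← ENNReal.toReal_add (h.lintegral_levelPrice_ne_top hv 0)
        (h.lintegral_levelPrice_ne_top hw _), ← lintegral_union measurableSet_Ioc
        (Ioc_disjoint_Ioc_of_le le_rfl), Ioc_union_Ioc_eq_Ioc (h.alloc_mem v hv).1 hx]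
    have up : (∫⁻ y in Ioc (x v) (x w), levelPrice s x y).toReal ≤ s w * (x w - x v) :=
      ENNReal.toReal_le_of_le_ofReal (mul_nonneg (h.nonneg w hw) (by linarith))
        (h.lintegral_levelPrice_le hw _)
    have low : s v * (x w - x v) ≤ (∫⁻ y in Ioc (x v) (x w), levelPrice s x y).toReal :=
      (ENNReal.ofReal_le_iff_le_toReal (h.lintegral_levelPrice_ne_top hw _)).1
        (h.le_lintegral_levelPrice hv _)
    have h1 := h.le v w hv hw
    have h2 := h.le w v hw hv
    have h3 := abs_le.1 (ih v hv hsv)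
    have hsw : s w = s v + d := by rw [hsv, hs]; push_cast; ring
    rw [hsw] at up h2
    rw [hadd, abs_le]
    constructor <;> nlinarith

/-- Payments are the integrals of the level prices. -/
theorem lintegral_levelPrice_eq (h : IncentiveCompatible s x c) {v : ℝ} (hv : 0 ≤ v) :
    ∫⁻ y in Ioc 0 (x v), levelPrice s x y = ENNReal.ofReal (c v) := by
  have key : ∀ e > 0, |(∫⁻ y in Ioc 0 (x v), levelPrice s x y).toReal - c v| ≤ e := by
    intro e he
    rcases (h.nonneg v hv).eq_or_lt with h0 | h0
    · refine (h.abs_integral_sub_pay_le he 0 v hv (by simp [h0.symm])).trans ?_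
      nlinarith [(h.alloc_mem v hv).2]
    · obtain ⟨n, hn⟩ := exists_nat_gt (s v / e)
      have hn0 : (0 : ℝ) < n := (by positivity : 0 < s v / e).trans hn
      refine (h.abs_integral_sub_pay_le (d := s v / n) (by positivity) n v hv
        (by field_simp)).trans ?_
      have h1 : s v / n ≤ e := by
        rw [div_le_iff₀ hn0]
        rw [div_lt_iff₀ he] at hn
        linarith
      have := mul_le_mul_of_nonneg_left (h.alloc_mem v hv).2 (by positivity : 0 ≤ s v / n)
      linarith
  have h0 : |(∫⁻ y in Ioc 0 (x v), levelPrice s x y).toReal - c v| ≤ 0 :=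
    le_of_forall_pos_le_add fun e he => by simpa using key e he
  rw [← sub_eq_zero.1 (abs_nonpos_iff.1 h0),
    ENNReal.ofReal_toReal (h.lintegral_levelPrice_ne_top hv 0)]

end IncentiveCompatible

/-! ### Upper bounds for Bob's revenue -/

/-- Fubini over types and levels. A level `y ≤ x v` satisfies `levelPrice s x y ≤ s v`; enlarging
the region of integration to the latter condition makes the sections depend on `s` alone. -/
theorem IncentiveCompatible.lintegral_pay_le {s x c : ℝ → ℝ} (h : IncentiveCompatible s x c)
    {D : Measure ℝ} [SFinite D] (hD : D (Iio 0) = 0) {pay k : ℝ → ℝ≥0∞} (hk : Measurable k)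
    (hpay : ∀ v, 0 ≤ v → pay v ≤ ∫⁻ y in Ioc 0 (x v), k y) :
    ∫⁻ v, pay v ∂D ≤ ∫⁻ y in Ioc (0 : ℝ) 1,
      k y * D {v | 0 ≤ v ∧ levelPrice s x y ≤ ENNReal.ofReal (s v)} := by
  let E : Set (ℝ × ℝ) := {q | 0 ≤ q.1 ∧ levelPrice s x q.2 ≤ ENNReal.ofReal (s q.1)}
  have hE : MeasurableSet E := by
    have h1 : MeasurableSet {q : ℝ × ℝ | 0 ≤ q.1} :=
      measurableSet_le measurable_const measurable_fst
    have h2 : MeasurableSet {q : ℝ × ℝ | levelPrice s x q.2 ≤ ENNReal.ofReal (s q.1)} :=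
      measurableSet_le ((monotone_levelPrice s x).measurable.comp measurable_snd)
        (h.continuous.measurable.comp measurable_fst).ennreal_ofReal
    exact h1.inter h2
  have hae : ∀ᵐ v ∂D, 0 ≤ v := by
    rw [ae_iff]
    simpa [Iio] using hD
  have hle : ∀ v, 0 ≤ v → pay v ≤ ∫⁻ y in Ioc (0 : ℝ) 1, E.indicator (fun q => k q.2) (v, y) := by
    intro v hv
    calc pay v ≤ ∫⁻ y in Ioc 0 (x v), k y := hpay v hv
      _ = ∫⁻ y in Ioc 0 (x v), E.indicator (fun q => k q.2) (v, y) := by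
        refine setLIntegral_congr_fun measurableSet_Ioc fun y hy => ?_
        have : (v, y) ∈ E := ⟨hv, levelPrice_le hv hy.2⟩
        simp only [indicator_of_mem this]
      _ ≤ _ := lintegral_mono_set (Ioc_subset_Ioc_right (h.alloc_mem v hv).2)
  calc ∫⁻ v, pay v ∂D
      ≤ ∫⁻ v, (∫⁻ y in Ioc (0 : ℝ) 1, E.indicator (fun q => k q.2) (v, y)) ∂D :=
        lintegral_mono_ae (hae.mono hle)
    _ = ∫⁻ y in Ioc (0 : ℝ) 1, ∫⁻ v, E.indicator (fun q => k q.2) (v, y) ∂D :=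
        lintegral_lintegral_swap (f := fun v y => E.indicator (fun q => k q.2) (v, y))
          ((hk.comp measurable_snd).indicator hE).aemeasurable
    _ = _ := by
        refine lintegral_congr fun y => ?_
        have : (fun v => E.indicator (fun q => k q.2) (v, y)) =
            {v | 0 ≤ v ∧ levelPrice s x y ≤ ENNReal.ofReal (s v)}.indicator fun _ => k y := by
          funext v
          simp only [indicator, E, mem_ofPred_eq]
        have hm : MeasurableSet {v | 0 ≤ v ∧ levelPrice s x y ≤ ENNReal.ofReal (s v)} :=
          hE.preimage (by fun_prop : Measurable fun v => (v, y))
        rw [this, lintegral_indicator_const hm]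

/-! ### Level prices of Bob's mechanism and the split at the cheap level. -/

/-- The probabilities that the types `v` choose from Bob. -/
noncomputable def choiceB (z p : ℝ) (B : Pricing) (v : ℝ) : ℝ := (choice (singleLottery z p) B v).xB

/-- The effective payments of the types `v`. -/
noncomputable def choicePay (z p : ℝ) (B : Pricing) (v : ℝ) : ℝ :=
  effectivePrice z p (choiceB z p B v) (B (choiceB z p B v)).toReal

section

variable {z p : ℝ} {B : Pricing}

theorem choiceB_feasible (hz : z ∈ Icc (0 : ℝ) 1) (hp : 0 ≤ p) (hB : IsProper B) {v : ℝ}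
    (hv : 0 ≤ v) : choiceB z p B v ∈ Icc (0 : ℝ) 1 ∧ B (choiceB z p B v) ≠ ∞ :=
  ((feasible_singleLottery_iff hz.2).1 (isChoice_choice hz hp hB hv).1).2

theorem effectivePrice_nonneg (hz : z ∈ Icc (0 : ℝ) 1) (hp : 0 ≤ p) {x b : ℝ} (hx : 0 ≤ x)
    (hb : 0 ≤ b) : 0 ≤ effectivePrice z p x b :=
  le_min hb (add_nonneg (mul_nonneg (mul_nonneg hz.1 hp) hx) (mul_nonneg (sub_nonneg.2 hz.2) hb))

theorem incentiveCompatible_choice (hz : z ∈ Icc (0 : ℝ) 1) (hp : 0 ≤ p) (hB : IsProper B) :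
    IncentiveCompatible (effectiveValue z p) (choiceB z p B) (choicePay z p B) where
  continuous := continuous_effectiveValue z p
  zero := effectiveValue_of_le hp
  nonneg := fun _ hv => effectiveValue_nonneg hz hp hv
  alloc_mem := fun _ hv => (choiceB_feasible hz hp hB hv).1
  pay_nonneg := fun _ hv => effectivePrice_nonneg hz hp (choiceB_feasible hz hp hB hv).1.1
    ENNReal.toReal_nonneg
  pay_zero := by
    refine le_antisymm ?_ (effectivePrice_nonneg hz hp (choiceB_feasible hz hp hB le_rfl).1.1
      ENNReal.toReal_nonneg)
    have := ((isChoice_choice hz hp hB le_rfl).outcome hz hp hB).1 0 le_rfl zero_le_one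
      (by rw [hB.map_zero]; simp)
    rw [effectiveValue_of_le hp, hB.map_zero] at this
    simpa [effectivePrice, choicePay, choiceB] using this
  le := fun v w hv hw => by
    obtain ⟨⟨h0, h1⟩, h2⟩ := choiceB_feasible hz hp hB hw
    exact ((isChoice_choice hz hp hB hv).outcome hz hp hB).1 _ h0 h1 h2

/-- The largest probability that Bob sells at an average price of at most `p`. -/
noncomputable def cheapLevel (z p : ℝ) (B : Pricing) : ℝ :=
  sSup {y | ∃ v, 0 ≤ v ∧ choiceB z p B v = y ∧ (B y).toReal ≤ p * y}

theorem le_cheapLevel (hz : z ∈ Icc (0 : ℝ) 1) (hp : 0 ≤ p) (hB : IsProper B) {v : ℝ}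
    (hv : 0 ≤ v) (h : (B (choiceB z p B v)).toReal ≤ p * choiceB z p B v) :
    choiceB z p B v ≤ cheapLevel z p B := by
  refine le_csSup ⟨1, ?_⟩ ⟨v, hv, rfl, h⟩
  rintro _ ⟨w, hw, rfl, _⟩
  exact (choiceB_feasible hz hp hB hw).1.2

theorem cheapLevel_mem (hz : z ∈ Icc (0 : ℝ) 1) (hp : 0 ≤ p) (hB : IsProper B) :
    cheapLevel z p B ∈ Icc (0 : ℝ) 1 := by
  constructor
  · apply Real.sSup_nonneg
    rintro _ ⟨w, hw, rfl, _⟩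
    exact (choiceB_feasible hz hp hB hw).1.1
  · apply Real.sSup_le _ zero_le_one
    rintro _ ⟨w, hw, rfl, _⟩
    exact (choiceB_feasible hz hp hB hw).1.2

/-- The marginal payment to Bob at the level `y`: above the cheap level, the buyer visits Bob only
after Alice. -/
noncomputable def marginalPay (z p : ℝ) (B : Pricing) (y : ℝ) : ℝ≥0∞ :=
  if y ≤ cheapLevel z p B then levelPrice (effectiveValue z p) (choiceB z p B) y
  else levelPrice (effectiveValue z p) (choiceB z p B) y - ENNReal.ofReal (z * p)

theorem measurable_marginalPay (z p : ℝ) (B : Pricing) : Measurable (marginalPay z p B) :=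
  Measurable.ite measurableSet_Iic (monotone_levelPrice _ _).measurable
    ((monotone_levelPrice _ _).measurable.sub_const _)

theorem marginalPay_le (z p : ℝ) (B : Pricing) (y : ℝ) :
    marginalPay z p B y ≤ levelPrice (effectiveValue z p) (choiceB z p B) y := by
  unfold marginalPay; split_ifs
  · exact le_rfl
  · exact tsub_le_self

theorem effectivePrice_of_le (hz : 0 ≤ z) {x b : ℝ} (h : b ≤ p * x) :
    effectivePrice z p x b = b := min_eq_left (by nlinarith)

theorem effectivePrice_of_ge (hz : 0 ≤ z) {x b : ℝ} (h : p * x ≤ b) :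
    effectivePrice z p x b = z * p * x + (1 - z) * b := min_eq_right (by nlinarith)

/-- A cheap purchase stays below the cheap level, where the marginal payment is the full level
price. For a dear purchase Bob gets at most the effective payment minus `z p x`; not subtracting `z
p` below the cheap level only increases the bound. -/
theorem payB_choice_le (hz : z ∈ Icc (0 : ℝ) 1) (hp : 0 ≤ p) (hB : IsProper B) {v : ℝ}
    (hv : 0 ≤ v) : payB B (choice (singleLottery z p) B v) ≤
      ∫⁻ y in Ioc 0 (choiceB z p B v), marginalPay z p B y := by
  have hic := (incentiveCompatible_choice hz hp hB).lintegral_levelPrice_eq hv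
  obtain ⟨⟨hx0, hx1⟩, ht⟩ := choiceB_feasible hz hp hB hv
  rcases ((isChoice_choice hz hp hB hv).outcome hz hp hB).2 with ⟨hb, hpay⟩ | ⟨hb, -, hpay⟩
  · change (B (choiceB z p B v)).toReal ≤ p * choiceB z p B v at hb
    change _ ≤ B (choiceB z p B v) at hpay
    rw [choicePay, effectivePrice_of_le hz.1 hb, ENNReal.ofReal_toReal ht] at hic
    rw [← hic] at hpay
    refine hpay.trans (le_of_eq (setLIntegral_congr_fun measurableSet_Ioc fun y hy => ?_))
    exact (if_pos (hy.2.trans (le_cheapLevel hz hp hB hv hb))).symm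
  · change p * choiceB z p B v ≤ (B (choiceB z p B v)).toReal at hb
    change _ ≤ ENNReal.ofReal (1 - z) * B (choiceB z p B v) at hpay
    rw [choicePay, effectivePrice_of_ge hz.1 hb] at hic
    calc _ ≤ ENNReal.ofReal (1 - z) * B (choiceB z p B v) := hpay
      _ = ENNReal.ofReal (z * p * choiceB z p B v + (1 - z) * (B (choiceB z p B v)).toReal) -
          ENNReal.ofReal (z * p * choiceB z p B v) := by
        rw [← ENNReal.ofReal_sub _ (mul_nonneg (mul_nonneg hz.1 hp) hx0), add_sub_cancel_left,
          ENNReal.ofReal_mul (sub_nonneg.2 hz.2), ENNReal.ofReal_toReal ht]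
      _ = (∫⁻ y in Ioc 0 (choiceB z p B v), levelPrice (effectiveValue z p) (choiceB z p B) y) -
          ∫⁻ _ in Ioc 0 (choiceB z p B v), ENNReal.ofReal (z * p) := by
        rw [hic, setLIntegral_const, Real.volume_Ioc, sub_zero,
          ENNReal.ofReal_mul (mul_nonneg hz.1 hp)]
      _ ≤ ∫⁻ y in Ioc 0 (choiceB z p B v),
          (levelPrice (effectiveValue z p) (choiceB z p B) y - ENNReal.ofReal (z * p)) :=
        lintegral_sub_le _ _ measurable_const
      _ ≤ _ := by
        refine lintegral_mono fun y => ?_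
        unfold marginalPay; split_ifs
        · exact tsub_le_self
        · exact le_rfl

/-- For a cheap purchase `x` the integral of level prices up to `x` is Bob's price, at most `p x`.
The supremum `X` need not be attained, so the bound is proved below each `a < X` and passed to the
limit. -/
theorem lintegral_levelPrice_cheap (hz : z ∈ Icc (0 : ℝ) 1) (hp : 0 ≤ p) (hB : IsProper B) :
    ∫⁻ y in Ioc 0 (cheapLevel z p B), levelPrice (effectiveValue z p) (choiceB z p B) y ≤
      ENNReal.ofReal (p * cheapLevel z p B) := by
  set X := cheapLevel z p B with hX
  set β := levelPrice (effectiveValue z p) (choiceB z p B)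
  have hlt : ∀ a, a < X → ∫⁻ y in Ioc 0 a, β y ≤ ENNReal.ofReal (p * X) := by
    intro a ha
    rcases le_or_gt a 0 with ha0 | ha0
    · simp [Ioc_eq_empty_of_le ha0]
    have hne : {y | ∃ v, 0 ≤ v ∧ choiceB z p B v = y ∧ (B y).toReal ≤ p * y}.Nonempty := by
      by_contra hemp
      rw [not_nonempty_iff_eq_empty] at hemp
      rw [hX, cheapLevel, hemp, Real.sSup_empty] at ha
      linarith
    obtain ⟨_, ⟨v, hv, rfl, hb⟩, hav⟩ := exists_lt_of_lt_csSup hne ha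
    calc ∫⁻ y in Ioc 0 a, β y ≤ ∫⁻ y in Ioc 0 (choiceB z p B v), β y :=
          lintegral_mono_set (Ioc_subset_Ioc_right hav.le)
      _ = ENNReal.ofReal (choicePay z p B v) :=
          (incentiveCompatible_choice hz hp hB).lintegral_levelPrice_eq hv
      _ ≤ _ := by
          refine ENNReal.ofReal_le_ofReal ?_
          rw [choicePay, effectivePrice_of_le hz.1 hb]
          exact hb.trans (mul_le_mul_of_nonneg_left (le_cheapLevel hz hp hB hv hb) hp)
  rw [setLIntegral_congr (Ioo_ae_eq_Ioc (μ := volume) (a := (0 : ℝ)) (b := X)).symm]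
  have hU : Ioo 0 X = ⋃ n : ℕ, Ioc 0 (X - 1 / ((n : ℝ) + 1)) := by
    ext y
    simp only [mem_Ioo, mem_iUnion, mem_Ioc, exists_and_left]
    refine and_congr_right fun _ => ⟨fun h => ?_, fun ⟨n, hn⟩ => ?_⟩
    · obtain ⟨n, hn⟩ := exists_nat_one_div_lt (sub_pos.2 h)
      exact ⟨n, by linarith⟩
    · have : (0 : ℝ) < 1 / ((n : ℝ) + 1) := by positivity
      linarith
  have hdir : Directed (· ⊆ ·) fun n : ℕ => Ioc 0 (X - 1 / ((n : ℝ) + 1)) := by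
    refine Monotone.directed_le fun m n hmn => Ioc_subset_Ioc_right ?_
    have : (m : ℝ) ≤ n := by exact_mod_cast hmn
    gcongr
  rw [hU, setLIntegral_iUnion_of_directed _ hdir]
  refine iSup_le fun n => hlt _ ?_
  have : (0 : ℝ) < 1 / ((n : ℝ) + 1) := by positivity
  linarith

/-- Buying more than the cheap level means buying dearly, which only types `v ≥ p` do, and their
effective values are at least `p`. -/
theorem le_levelPrice_of_cheapLevel_lt (hz : z ∈ Icc (0 : ℝ) 1) (hp : 0 ≤ p) (hB : IsProper B)
    {y : ℝ} (hy : cheapLevel z p B < y) :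
    ENNReal.ofReal p ≤ levelPrice (effectiveValue z p) (choiceB z p B) y := by
  refine le_iInf₂ fun v hv => ENNReal.ofReal_le_ofReal ?_
  rcases ((isChoice_choice hz hp hB hv.1).outcome hz hp hB).2 with ⟨hb, -⟩ | ⟨-, hpv, -⟩
  · exact absurd (le_cheapLevel hz hp hB hv.1 hb) (not_le.2 (hy.trans_le hv.2))
  · rw [effectiveValue_of_ge hpv]
    nlinarith [hz.2]

theorem revB_le_lintegral (hD : IsValueDistribution D f) (hz : z ∈ Icc (0 : ℝ) 1) (hp : 0 ≤ p)
    (hB : IsProper B) :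
    revB (singleLottery z p) B D ≤ ∫⁻ y in Ioc (0 : ℝ) 1, marginalPay z p B y *
      D {v | 0 ≤ v ∧ levelPrice (effectiveValue z p) (choiceB z p B) y ≤
        ENNReal.ofReal (effectiveValue z p v)} := by
  have := hD.isProbabilityMeasure
  exact (incentiveCompatible_choice hz hp hB).lintegral_pay_le hD.nonneg_values
    (measurable_marginalPay z p B) fun v hv => payB_choice_le hz hp hB hv

/-- Levels that no type buys have level price `∞`. Their tail is null, so they contribute `∞ * 0 =
0` to the revenue bound. -/
theorem measure_levelPrice_le (hz : z ∈ Icc (0 : ℝ) 1) (hp : 0 ≤ p) (b : ℝ≥0∞) :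
    b = ∞ ∧ D {v | 0 ≤ v ∧ b ≤ ENNReal.ofReal (effectiveValue z p v)} = 0 ∨
    ∃ s, 0 ≤ s ∧ b = ENNReal.ofReal s ∧
      D {v | 0 ≤ v ∧ b ≤ ENNReal.ofReal (effectiveValue z p v)} ≤
        D {v | s ≤ effectiveValue z p v} := by
  rcases eq_or_ne b ∞ with rfl | hb
  · left
    simp [top_le_iff]
  · refine Or.inr ⟨b.toReal, ENNReal.toReal_nonneg, (ENNReal.ofReal_toReal hb).symm,
      measure_mono fun v hv => ?_⟩
    exact (ENNReal.le_ofReal_iff_toReal_le hb (effectiveValue_nonneg hz hp hv.1)).1 hv.2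

theorem revB_le_revenueCurve (hD : IsValueDistribution D f) (hz : z ∈ Icc (0 : ℝ) 1) (hp : 0 ≤ p)
    (hB : IsProper B) {vM : ℝ} (hvM : IsMyersonPrice D vM) :
    revB (singleLottery z p) B D ≤ ENNReal.ofReal (revenueCurve D vM) := by
  refine (revB_le_lintegral hD hz hp hB).trans ?_
  calc _ ≤ ∫⁻ _ in Ioc (0 : ℝ) 1, ENNReal.ofReal (revenueCurve D vM) := by
        refine lintegral_mono fun y => ?_
        grw [marginalPay_le]
        rcases measure_levelPrice_le (D := D) hz hp
          (levelPrice (effectiveValue z p) (choiceB z p B) y) with ⟨_, h⟩ | ⟨s, hs, he, h⟩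
        · rw [h]; simp
        · grw [h, he]
          exact mul_effectiveValue_tail_le hD hz hvM hp hs
    _ = _ := by simp

/-- Below the cheap level `X`, integrating the supporting line gives `(R p - l p) X + l ∫ β`; since
`l ≥ 0` and `∫ β ≤ p X`, this is at most `X R p`. Above `X` the bound holds level by level. -/
theorem revB_le_convexCombination (hD : IsValueDistribution D f) (hz : z ∈ Icc (0 : ℝ) 1)
    (hp : 0 ≤ p) (hB : IsProper B) {vM l : ℝ} (hvM : IsMyersonPrice D vM) (hl : 0 ≤ l)
    (hsup : ∀ t, 0 ≤ t → revenueCurve D t ≤ revenueCurve D p + l * (t - p)) :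
    revB (singleLottery z p) B D ≤
      ENNReal.ofReal (cheapLevel z p B * revenueCurve D p +
        (1 - cheapLevel z p B) * ((1 - z) * revenueCurve D vM)) := by
  obtain ⟨hX0, hX1⟩ := cheapLevel_mem hz hp hB
  have hcheap := lintegral_levelPrice_cheap hz hp hB
  set X := cheapLevel z p B with hX
  set β := levelPrice (effectiveValue z p) (choiceB z p B) with hβ
  have hG0 : 0 ≤ revenueCurve D p - l * p := by
    have := hsup 0 le_rfl
    simp only [revenueCurve, zero_mul, zero_sub] at this
    simp only [revenueCurve]; linarith
  have hGp : 0 ≤ revenueCurve D p := mul_nonneg hp (one_sub_cdf_nonneg D p)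
  have hGM : 0 ≤ (1 - z) * revenueCurve D vM :=
    mul_nonneg (sub_nonneg.2 hz.2) (mul_nonneg hvM.1 (one_sub_cdf_nonneg D vM))
  refine (revB_le_lintegral hD hz hp hB).trans ?_
  rw [← hβ, ← Ioc_union_Ioc_eq_Ioc hX0 hX1, lintegral_union measurableSet_Ioc
    (Ioc_disjoint_Ioc_of_le le_rfl), ENNReal.ofReal_add (mul_nonneg hX0 hGp)
    (mul_nonneg (sub_nonneg.2 hX1) hGM)]
  gcongr ?_ + ?_
  · calc _ ≤ ∫⁻ y in Ioc 0 X, (ENNReal.ofReal (revenueCurve D p - l * p) +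
          ENNReal.ofReal l * β y) := by
          refine lintegral_mono fun y => ?_
          grw [marginalPay_le]
          rcases measure_levelPrice_le (D := D) hz hp (β y) with ⟨_, h⟩ | ⟨s, hs, he, h⟩
          · rw [h]; simp
          · grw [h]
            rw [← hβ, he]
            exact mul_effectiveValue_tail_le_support hD hz hp hs hl hsup
      _ = ENNReal.ofReal ((revenueCurve D p - l * p) * X) +
          ENNReal.ofReal l * ∫⁻ y in Ioc 0 X, β y := by
          rw [lintegral_add_left measurable_const, lintegral_const_mul _
            (monotone_levelPrice _ _).measurable, setLIntegral_const, Real.volume_Ioc, sub_zero,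
            ENNReal.ofReal_mul hG0]
      _ ≤ ENNReal.ofReal ((revenueCurve D p - l * p) * X) +
          ENNReal.ofReal l * ENNReal.ofReal (p * X) := by gcongr
      _ = _ := by
          rw [← ENNReal.ofReal_mul hl, ← ENNReal.ofReal_add (mul_nonneg hG0 hX0) (by positivity)]
          congr 1; ring
  · calc _ ≤ ∫⁻ _ in Ioc X 1, ENNReal.ofReal ((1 - z) * revenueCurve D vM) := by
          refine setLIntegral_mono measurable_const fun y hy => ?_
          have hm : marginalPay z p B y = β y - ENNReal.ofReal (z * p) := if_neg (not_le.2 hy.1)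
          have hpy := le_levelPrice_of_cheapLevel_lt hz hp hB hy.1
          rw [hm]
          rcases measure_levelPrice_le (D := D) hz hp (β y) with ⟨_, h⟩ | ⟨s, hs, he, h⟩
          · rw [h]; simp
          · grw [h]
            rw [← hβ, he, ENNReal.ofReal_le_ofReal_iff hs] at hpy
            rw [he, ← ENNReal.ofReal_sub _ (mul_nonneg hz.1 hp)]
            exact mul_effectiveValue_tail_le_second hD hz hp hpy hvM
      _ = _ := by
          rw [setLIntegral_const, Real.volume_Ioc, mul_comm, ← ENNReal.ofReal_mul (by linarith)]

end

end Duopoly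

/-! ### Choice of the fixed price. -/

theorem lemma3p2 (D : MeasureTheory.Measure ℝ) (f : ℝ → ℝ)
    (hD : Duopoly.IsValueDistribution D f)
    (hreg : Duopoly.IsRegular D f ∨ Duopoly.IsDMR D f)
    (vM : ℝ) (hvM : Duopoly.IsMyersonPrice D vM)
    (z p : ℝ) (hz : z ∈ Set.Icc (0 : ℝ) 1) (hp : 0 ≤ p)
    (B : Duopoly.Pricing) (hB : Duopoly.IsProper B) :
    ∃ q : ℝ, 0 ≤ q ∧
      Duopoly.revB (Duopoly.singleLottery z p) B D ≤
        Duopoly.revB (Duopoly.singleLottery z p) (Duopoly.fixedPrice q) D ∧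
      ((∀ p' ∈ Set.Icc 0 p,
          Duopoly.revB (Duopoly.singleLottery z p) (Duopoly.fixedPrice p') D <
            Duopoly.revB (Duopoly.singleLottery z p) (Duopoly.fixedPrice vM) D) →
        (∃ v : ℝ, p ≤ v ∧
          Duopoly.payA (Duopoly.singleLottery z p)
            (Duopoly.choice (Duopoly.singleLottery z p) B v) < ENNReal.ofReal (p * z)) →
        Duopoly.revB (Duopoly.singleLottery z p) B D <
          Duopoly.revB (Duopoly.singleLottery z p) (Duopoly.fixedPrice q) D) := by
  open Duopoly in
  -- A monopoly price `q ≤ p` earns the full monopoly revenue despite Alice. No mechanism beats it,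
  -- not even the price `vM`, so the premise of the strict part fails.
  by_cases hq : ∃ q, q ≤ p ∧ IsMyersonPrice D q
  · obtain ⟨q, hqp, hqM⟩ := hq
    have hlow := revenueCurve_le_revB hD hz hqM.1 hqp
    refine ⟨q, hqM.1, (revB_le_revenueCurve hD hz hp hB hqM).trans hlow, fun hlt => ?_⟩
    have h1 := hlt q ⟨hqM.1, hqp⟩
    have h2 := (revB_le_revenueCurve hD hz hp (isProper_fixedPrice hvM.1) hqM).trans hlow
    exact absurd h1 (not_lt.2 h2)
  push Not at hq
  obtain ⟨l, hl, hsup⟩ := exists_support_of_no_myersonPrice_le hD hreg hvM hp hq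
  have hpv : p ≤ vM := by
    by_contra! h
    exact hq vM h.le hvM
  have hup := fun {B : Pricing} (hB : IsProper B) =>
    revB_le_convexCombination hD hz hp hB hvM hl hsup
  have hlowp := revenueCurve_le_revB hD hz hp le_rfl
  have hlowM := mul_revenueCurve_le_revB hD hz hp hpv
  -- The larger endpoint of the convex combination decides between `p` and `vM`. If it is `R p`, the
  -- price `p` is at least as good as `vM`, and the premise of the strict part fails again.
  rcases le_or_gt ((1 - z) * revenueCurve D vM) (revenueCurve D p) with hcmp | hcmp
  · have hle : ∀ {B : Pricing}, IsProper B → revB (singleLottery z p) B D ≤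
        revB (singleLottery z p) (fixedPrice p) D := by
      intro B hB
      refine ((hup hB).trans (ENNReal.ofReal_le_ofReal ?_)).trans hlowp
      have := mul_le_mul_of_nonneg_left hcmp (sub_nonneg.2 (cheapLevel_mem hz hp hB).2)
      linarith
    refine ⟨p, hp, hle hB, fun hlt => ?_⟩
    exact absurd (hlt p ⟨hp, le_rfl⟩) (not_lt.2 (hle (isProper_fixedPrice hvM.1)))
  · obtain ⟨hX0, hX1⟩ := cheapLevel_mem hz hp hB
    refine ⟨vM, hvM.1, ((hup hB).trans (ENNReal.ofReal_le_ofReal ?_)).trans hlowM, ?_⟩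
    · nlinarith
    · rintro - ⟨v, hv, hpay⟩
      have hv0 := hp.trans hv
      -- This type makes a positive cheap purchase, so the strictly smaller endpoint `R p` has
      -- positive weight.
      obtain ⟨hx, hb⟩ := (isChoice_choice hz hp hB hv0).of_payA_lt hz hp hB hv hpay
      have hX : 0 < cheapLevel z p B := hx.trans_le (le_cheapLevel hz hp hB hv0 hb)
      have hGp : 0 ≤ revenueCurve D p := mul_nonneg hp (one_sub_cdf_nonneg D p)
      refine (hup hB).trans_lt (lt_of_lt_of_le ?_ hlowM)
      rw [ENNReal.ofReal_lt_ofReal_iff (hGp.trans_lt hcmp)]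
      nlinarith
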